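/- Let $M$ be a smooth manifold (Hausdorff, without boundary, finite-dimensional), $\omega$ a smooth non-degenerate $2$-form on $M$ and $D$ a smooth linear connection on $M$ (possibly with torsion). The connection $D$ determines a decomposition $T(T^*M)=H^D\oplus T^{\mathrm{vert}}(T^*M)$ into the $D$-horizontal and the vertical subbundle, hence, identifying $H^D$ with $\pi^*(TM)$ by the differential of the projection $\pi:T^*M\to M$ and $T^{\mathrm{vert}}(T^*M)$ with $\pi^*(T^*M)$, an identification $T(T^*M)=\pi^*(TM\oplus T^*M)$. View $\omega$ as the isomorphism $TM\to T^*M$, $X\mapsto\omega(X,\cdot)$, and let $$\mathcal J^{\omega}=\begin{pmatrix}0&\omega^{-1}\\-\omega&0\end{pmatrix}\in\mathrm{End}(TM\oplus T^*M),\qquad \mathcal J^\omega(X+\xi)=\omega^{-1}(\xi)-\omega(X,\cdot).$$ Let $J:=\pi^*(\mathcal J^\omega)$ be the almost complex structure on the manifold $T^*M$ obtained from $\mathcal J^\omega$ by this identification. Call $J$ integrable if its holomorphic bundle (the $i$-eigenbundle of $J$ in $T^{\mathbb C}(T^*M)$) is involutive, i.e. its space of smooth sections is closed under the (complex bilinear)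 Lie bracket. Then $J$ is integrable if and only if both of the following conditions hold: 1. $D$ is flat, i.e. its curvature $R^D_{X,Y}=-D_XD_Y+D_YD_X+D_{[X,Y]}$ on $TM$ vanishes; 2. for all smooth vector fields $X,Y,Z$ on $M$, $$(d\omega)(X,Y,Z)-(D_Z\omega)(X,Y)-\omega(T^D_ZX,Y)-\omega(X,T^D_ZY)=0,$$ where $T^D_XY=D_XY-D_YX-[X,Y]$ is the torsion of $D$ and $$(d\omega)(X,Y,Z)=X(\omega(Y,Z))+Y(\omega(Z,X))+Z(\omega(X,Y))-\omega([X,Y],Z)-\omega([Y,Z],X)-\omega([Z,X],Y).$$ -/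

import Mathlib

open Bundle
open scoped Manifold ContDiff

noncomputable section

namespace CotangentGeometry

/-! Conventions. `M` is a smooth manifold without boundary, modelled on a finite-dimensional real
vector space `E`. A vector field on `M` is a function `X : Π x : M, TangentSpace 𝓘(ℝ, E) x`; its
smoothness is a separate assumption. -/

section Base

variable {E : Type*} [NormedAddCommGroup E] [NormedSpace ℝ E]
  {M : Type*} [TopologicalSpace M] [ChartedSpace E M]

variable (E M) in
/-- Vector fields on `M`. -/
abbrev VField : Type _ := Π x : M, TangentSpace 𝓘(ℝ, E) x

variable (E M) in
/-- 1-forms on `M`, i.e. sections of the cotangent bundle. -/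
abbrev OneForm : Type _ := Π x : M, TangentSpace 𝓘(ℝ, E) x →L[ℝ] ℝ

variable (E M) in
/-- Fields of bilinear forms on the tangent spaces of `M`. -/
abbrev BilinField : Type _ :=
  Π x : M, TangentSpace 𝓘(ℝ, E) x →L[ℝ] TangentSpace 𝓘(ℝ, E) x →L[ℝ] ℝ

instance (x : M) : T2Space (TangentSpace 𝓘(ℝ, E) x) := inferInstanceAs (T2Space E)

instance [FiniteDimensional ℝ E] (x : M) : FiniteDimensional ℝ (TangentSpace 𝓘(ℝ, E) x) :=
  inferInstanceAs (FiniteDimensional ℝ E)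

/-- The derivative `X(f)` of a function in the direction of a vector field. -/
def dirDeriv (X : VField E M) (f : M → ℝ) (x : M) : ℝ := mvfderiv 𝓘(ℝ, E) f x (X x)

open VectorField in
/-- The exterior derivative `(dΩ)(X, Y, Z)` of a 2-form, by the invariant formula (normalized
without the factor `1/3`). -/
def extDerivTwoForm (Ω : BilinField E M) (X Y Z : VField E M) (x : M) : ℝ :=
  dirDeriv X (fun y ↦ Ω y (Y y) (Z y)) x + dirDeriv Y (fun y ↦ Ω y (Z y) (X y)) x
    + dirDeriv Z (fun y ↦ Ω y (X y) (Y y)) x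
    - Ω x (mlieBracket 𝓘(ℝ, E) X Y x) (Z x) - Ω x (mlieBracket 𝓘(ℝ, E) Y Z x) (X x)
    - Ω x (mlieBracket 𝓘(ℝ, E) Z X x) (Y x)

variable [IsManifold 𝓘(ℝ, E) ∞ M]

/-- The vector field `X` on `M` is smooth. -/
def SmoothField (X : VField E M) : Prop :=
  ContMDiff 𝓘(ℝ, E) (𝓘(ℝ, E).prod 𝓘(ℝ, E)) ∞
    (fun x ↦ (TotalSpace.mk' E x (X x) : TangentBundle 𝓘(ℝ, E) M))

variable (E M) in
/-- A smooth non-degenerate 2-form on `M`. -/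
structure NondegenerateTwoForm where
  /-- The bilinear form on each tangent space. -/
  form : BilinField E M
  alternating (x : M) (v : TangentSpace 𝓘(ℝ, E) x) : form x v v = 0
  nondegenerate (x : M) (v : TangentSpace 𝓘(ℝ, E) x) : (∀ w, form x v w = 0) → v = 0
  smooth : ContMDiff 𝓘(ℝ, E) (𝓘(ℝ, E).prod 𝓘(ℝ, E →L[ℝ] E →L[ℝ] ℝ)) ∞
    (fun x ↦ TotalSpace.mk' (E →L[ℝ] E →L[ℝ] ℝ)
      (E := fun x : M ↦ TangentSpace 𝓘(ℝ, E) x →L[ℝ] TangentSpace 𝓘(ℝ, E) x →L[ℝ] ℝ) x (form x))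

variable (E M) in
/-- Linear connections on `M`: covariant derivatives on the tangent bundle. In Mathlib's notation
`D Y x (X x)` is the value of `D_X Y` at `x`. -/
abbrev LinearConnection : Type _ :=
  CovariantDerivative 𝓘(ℝ, E) E (TangentSpace 𝓘(ℝ, E) : M → Type _)

/-- The vector field `D_X Y`. -/
def covField (D : LinearConnection E M) (X Y : VField E M) : VField E M :=
  fun x ↦ D Y x (X x)

/-- The covariant derivative of a 2-form:
`(D_Z Ω)(X, Y) = Z(Ω(X, Y)) - Ω(D_Z X, Y) - Ω(X, D_Z Y)`. -/
def covDerivTwoForm (D : LinearConnection E M) (Ω : BilinField E M)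
    (Z X Y : VField E M) (x : M) : ℝ :=
  dirDeriv Z (fun y ↦ Ω y (X y) (Y y)) x - Ω x (covField D Z X x) (Y x)
    - Ω x (X x) (covField D Z Y x)

/-- The covariant derivative of a 1-form: `(D_X s)(Y) = X(s(Y)) - s(D_X Y)`. -/
def covDerivOneForm (D : LinearConnection E M) (s : OneForm E M) (X Y : VField E M) (x : M) : ℝ :=
  dirDeriv X (fun y ↦ s y (Y y)) x - s x (covField D X Y x)

open VectorField in
/-- The curvature `R^D_{X, Y} Z = - D_X D_Y Z + D_Y D_X Z + D_{[X, Y]} Z`. -/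
def curvature (D : LinearConnection E M) (X Y Z : VField E M) : VField E M :=
  fun x ↦ - covField D X (covField D Y Z) x + covField D Y (covField D X Z) x
    + covField D (mlieBracket 𝓘(ℝ, E) X Y) Z x

/-- `D` is flat: its curvature vanishes (its torsion need not vanish). -/
def IsFlat (D : LinearConnection E M) : Prop :=
  ∀ X Y Z : VField E M, SmoothField X → SmoothField Y → SmoothField Z →
    ∀ x, curvature D X Y Z x = 0

end Base

/-! ### The cotangent manifold and its decomposition determined by a connection -/

section Splitting

variable {E : Type*} [NormedAddCommGroup E] [NormedSpace ℝ E]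
  {M : Type*} [TopologicalSpace M] [ChartedSpace E M] [IsManifold 𝓘(ℝ, E) ∞ M]

variable (E M) in
/-- The cotangent manifold `T*M`: the total space of the cotangent bundle, with the topology and
the smooth structure that Mathlib gives to the vector bundle `Hom(TM, ℝ)`. -/
abbrev CotangentBundle : Type _ :=
  TotalSpace (E →L[ℝ] ℝ) (fun x : M ↦ TangentSpace 𝓘(ℝ, E) x →L[ℝ] ℝ)

variable (E) in
/-- The model (without boundary) of the cotangent manifold. -/
abbrev cotModel : ModelWithCorners ℝ (E × (E →L[ℝ] ℝ)) (ModelProd E (E →L[ℝ] ℝ)) :=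
  𝓘(ℝ, E).prod 𝓘(ℝ, E →L[ℝ] ℝ)

variable (E) in
/-- The fibre `T_x M ⊕ T*_x M` of the generalized tangent bundle. -/
abbrev GenTangentSpace (x : M) : Type _ :=
  TangentSpace 𝓘(ℝ, E) x × (TangentSpace 𝓘(ℝ, E) x →L[ℝ] ℝ)

/-- The differential at `γ` of the projection `π : T*M → M`. -/
def dproj (γ : CotangentBundle E M) :
    TangentSpace (cotModel E) γ →L[ℝ] TangentSpace 𝓘(ℝ, E) γ.proj :=
  mfderiv (cotModel E) 𝓘(ℝ, E) (fun γ : CotangentBundle E M ↦ γ.proj) γ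

/-- The tangent vector at `t = 0` of the line `t ↦ γ + t ξ` in the fibre of `T*M` through `γ`. -/
def vertLift (γ : CotangentBundle E M) (ξ : TangentSpace 𝓘(ℝ, E) γ.proj →L[ℝ] ℝ) :
    TangentSpace (cotModel E) γ :=
  mfderiv 𝓘(ℝ, ℝ) (cotModel E)
    (fun t : ℝ ↦ (⟨γ.proj, γ.2 + t • ξ⟩ : CotangentBundle E M)) 0 (1 : ℝ)

/-- A 1-form on `M` as a map `M → T*M`. -/
def sectionMap (s : OneForm E M) (x : M) : CotangentBundle E M := ⟨x, s x⟩

theorem mdifferentiableAt_dproj (γ : CotangentBundle E M) :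
    MDifferentiableAt (cotModel E) 𝓘(ℝ, E) (fun γ : CotangentBundle E M ↦ γ.proj) γ :=
  (contMDiffAt_proj (n := 1) (IB := 𝓘(ℝ, E)) _).mdifferentiableAt one_ne_zero

theorem mdifferentiableAt_line (γ : CotangentBundle E M)
    (ξ : TangentSpace 𝓘(ℝ, E) γ.proj →L[ℝ] ℝ) :
    MDifferentiableAt 𝓘(ℝ, ℝ) (cotModel E)
      (fun t : ℝ ↦ (⟨γ.proj, γ.2 + t • ξ⟩ : CotangentBundle E M)) 0 := by
  refine (mdifferentiableAt_totalSpace _ _).2 ⟨mdifferentiableAt_const, ?_⟩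
  let e := trivializationAt (E →L[ℝ] ℝ) (fun x : M ↦ TangentSpace 𝓘(ℝ, E) x →L[ℝ] ℝ) γ.proj
  have he : γ.proj ∈ e.baseSet := FiberBundle.mem_baseSet_trivializationAt' γ.proj
  have h : (fun t : ℝ ↦ (e ⟨γ.proj, γ.2 + t • ξ⟩).2)
      = fun t : ℝ ↦ (e ⟨γ.proj, γ.2⟩).2 + t • (e ⟨γ.proj, ξ⟩).2 := by
    funext t
    rw [(e.linear ℝ he).map_add, (e.linear ℝ he).map_smul]
  have h' : DifferentiableAt ℝ
      (fun t : ℝ ↦ (e ⟨γ.proj, γ.2⟩).2 + t • (e ⟨γ.proj, ξ⟩).2) 0 := by fun_prop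
  rw [← h] at h'
  exact h'.mdifferentiableAt

theorem dproj_section {s : OneForm E M} {x : M}
    (hs : MDifferentiableAt 𝓘(ℝ, E) (cotModel E) (sectionMap s) x) (v : TangentSpace 𝓘(ℝ, E) x) :
    dproj (sectionMap s x) (mfderiv 𝓘(ℝ, E) (cotModel E) (sectionMap s) x v) = v := by
  have h := mfderiv_comp x (mdifferentiableAt_dproj (sectionMap s x)) hs
  have h' : (fun γ : CotangentBundle E M ↦ γ.proj) ∘ sectionMap s = id := rfl
  rw [h', mfderiv_id] at h
  exact (DFunLike.congr_fun h v).symm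

theorem dproj_vertical (γ : CotangentBundle E M) (ξ : TangentSpace 𝓘(ℝ, E) γ.proj →L[ℝ] ℝ) :
    dproj γ (vertLift γ ξ) = 0 := by
  have h := mfderiv_comp_apply_of_eq _ (mdifferentiableAt_dproj γ) (mdifferentiableAt_line γ ξ)
    (by simp) (1 : ℝ)
  have h' : (fun γ : CotangentBundle E M ↦ γ.proj) ∘
    (fun t : ℝ ↦ (⟨γ.proj, γ.2 + t • ξ⟩ : CotangentBundle E M)) = fun _ ↦ γ.proj := rfl
  rw [h', mfderiv_const] at h
  exact h.symm

/-- The fibrewise linear function `γ ↦ γ(Y)` on `T*M` determined by a vector field `Y` on `M`. -/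
def fibLin (Y : VField E M) (γ : CotangentBundle E M) : ℝ := γ.2 (Y γ.proj)

theorem mdifferentiableAt_fibLin {Y : VField E M} {γ : CotangentBundle E M}
    (hY : MDifferentiableAt 𝓘(ℝ, E) (𝓘(ℝ, E).prod 𝓘(ℝ, E))
      (fun x ↦ (TotalSpace.mk' E x (Y x) : TangentBundle 𝓘(ℝ, E) M)) γ.proj) :
    MDifferentiableAt (cotModel E) 𝓘(ℝ, ℝ) (fibLin Y) γ := by
  have hpr := mdifferentiableAt_dproj γ
  have h2 := hY.comp γ hpr
  have h1 : MDifferentiableAt (cotModel E) (cotModel E)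
    (fun γ : CotangentBundle E M ↦ TotalSpace.mk' (E →L[ℝ] ℝ)
      (E := fun x : M ↦ TangentSpace 𝓘(ℝ, E) x →L[ℝ] ℝ) γ.proj γ.2) γ := mdifferentiableAt_id
  have h3 := MDifferentiableAt.clm_bundle_apply (F₁ := E) (F₂ := ℝ)
    (E₁ := fun x : M ↦ TangentSpace 𝓘(ℝ, E) x) (E₂ := Trivial M ℝ)
    (b := fun γ : CotangentBundle E M ↦ γ.proj) (ϕ := fun γ ↦ γ.2) (v := fun γ ↦ Y γ.proj) h1 h2
  exact ((mdifferentiableAt_totalSpace _ _).1 h3).2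

/-- The function whose value at `(V, Y)` is `V(γ ↦ γ(Y)) - γ(D_{dπ(V)} Y)`. -/
def connectorAux (D : LinearConnection E M) (γ : CotangentBundle E M)
    (Y : VField E M) : TangentSpace (cotModel E) γ →L[ℝ] ℝ :=
  mvfderiv (cotModel E) (fibLin Y) γ - γ.2 ∘L (D Y γ.proj) ∘L (dproj γ)

theorem tensorialAt_connectorAux (D : LinearConnection E M) (γ : CotangentBundle E M)
    (V : TangentSpace (cotModel E) γ) :
    TensorialAt 𝓘(ℝ, E) E (fun Y : VField E M ↦ connectorAux D γ Y V) γ.proj where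
  smul {f Y} hf hY := by
    have hpr := mdifferentiableAt_dproj γ
    have hfp : MDifferentiableAt (cotModel E) 𝓘(ℝ, ℝ)
        (fun γ : CotangentBundle E M ↦ f γ.proj) γ := hf.comp γ hpr
    have h1 : fibLin (f • Y) = (fun γ : CotangentBundle E M ↦ f γ.proj) * fibLin Y := by
      funext γ'
      simp [fibLin]
    have h2 : mvfderiv (cotModel E) (fun γ : CotangentBundle E M ↦ f γ.proj) γ
        = (mvfderiv 𝓘(ℝ, E) f γ.proj) ∘L (dproj γ) := mfderiv_comp γ hf hpr
    simp only [connectorAux, h1, mvfderiv_mul hfp (mdifferentiableAt_fibLin hY), h2,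
      D.isCovariantDerivativeOnUniv.leibniz hY hf]
    simp [fibLin]
    ring
  add {Y Y'} hY hY' := by
    have h1 : (fibLin (Y + Y') : CotangentBundle E M → ℝ) = fibLin Y + fibLin Y' := by
      funext γ'
      simp [fibLin]
    simp only [connectorAux, h1, mvfderiv_add (mdifferentiableAt_fibLin hY)
      (mdifferentiableAt_fibLin hY'), D.isCovariantDerivativeOnUniv.add hY hY']
    simp
    ring

variable [FiniteDimensional ℝ E]

/-- The vertical part of a tangent vector of `T*M` with respect to the connection `D`, as a map
`T_γ(T*M) → T*_x M`, `x = π(γ)`. It is the covector `K(V)` with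
`K(V)(Y x) = V(γ ↦ γ(Y)) - γ(D_{dπ(V)} Y)` for every vector field `Y` differentiable at `x`.
The horizontal space of `D` at `γ` is its kernel: by `connector_section` below, `K(ds(X)) = D_X s`
for every 1-form `s`, so a vector `ds(X)` tangent to the section `s` is horizontal if and only
if `D_X s = 0`. By `connector_vertical`, on vectors tangent to the fibre it is the canonical
identification of the vertical space with `T*_x M`. -/
def connector (D : LinearConnection E M) (γ : CotangentBundle E M) :
    TangentSpace (cotModel E) γ →ₗ[ℝ] (TangentSpace 𝓘(ℝ, E) γ.proj →L[ℝ] ℝ) where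
  toFun V := TensorialAt.mkHom (fun Y : VField E M ↦ connectorAux D γ Y V) γ.proj
    (tensorialAt_connectorAux D γ V)
  map_add' V W := by
    ext v
    exact map_add (connectorAux D γ (FiberBundle.extend E v)) V W
  map_smul' c V := by
    ext v
    exact map_smul (connectorAux D γ (FiberBundle.extend E v)) c V

theorem connector_apply (D : LinearConnection E M) (γ : CotangentBundle E M)
    (V : TangentSpace (cotModel E) γ) {Y : VField E M}
    (hY : MDifferentiableAt 𝓘(ℝ, E) (𝓘(ℝ, E).prod 𝓘(ℝ, E))
      (fun x ↦ (TotalSpace.mk' E x (Y x) : TangentBundle 𝓘(ℝ, E) M)) γ.proj) :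
    connector D γ V (Y γ.proj)
      = mvfderiv (cotModel E) (fibLin Y) γ V - γ.2 (D Y γ.proj (dproj γ V)) :=
  TensorialAt.mkHom_apply _ hY

theorem connector_section (D : LinearConnection E M) {s : OneForm E M} {X Y : VField E M} {x : M}
    (hs : MDifferentiableAt 𝓘(ℝ, E) (cotModel E) (sectionMap s) x)
    (hY : MDifferentiableAt 𝓘(ℝ, E) (𝓘(ℝ, E).prod 𝓘(ℝ, E))
      (fun x ↦ (TotalSpace.mk' E x (Y x) : TangentBundle 𝓘(ℝ, E) M)) x) :
    connector D (sectionMap s x) (mfderiv 𝓘(ℝ, E) (cotModel E) (sectionMap s) x (X x)) (Y x)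
      = covDerivOneForm D s X Y x := by
  have h := mfderiv_comp x (mdifferentiableAt_fibLin (γ := sectionMap s x) hY) hs
  have h2 := connector_apply D (sectionMap s x)
    (mfderiv 𝓘(ℝ, E) (cotModel E) (sectionMap s) x (X x)) hY
  rw [dproj_section hs] at h2
  refine h2.trans ?_
  exact congrArg (fun r : ℝ ↦ r - s x (D Y x (X x))) (DFunLike.congr_fun h (X x)).symm

theorem connector_vertical (D : LinearConnection E M) (γ : CotangentBundle E M)
    (ξ : TangentSpace 𝓘(ℝ, E) γ.proj →L[ℝ] ℝ) :
    connector D γ (vertLift γ ξ) = ξ := by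
  ext v
  obtain ⟨Y, hY, rfl⟩ : ∃ Y : VField E M, MDifferentiableAt 𝓘(ℝ, E) (𝓘(ℝ, E).prod 𝓘(ℝ, E))
      (fun x ↦ (TotalSpace.mk' E x (Y x) : TangentBundle 𝓘(ℝ, E) M)) γ.proj ∧ Y γ.proj = v :=
    ⟨FiberBundle.extend E v, FiberBundle.mdifferentiableAt_extend .., by simp⟩
  rw [connector_apply D γ _ hY, dproj_vertical]
  have h := mfderiv_comp_apply_of_eq _ (mdifferentiableAt_fibLin hY) (mdifferentiableAt_line γ ξ)
    (by simp) (1 : ℝ)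
  have h' : fibLin Y ∘
      (fun t : ℝ ↦ (⟨γ.proj, γ.2 + t • ξ⟩ : CotangentBundle E M))
        = fun t ↦ γ.2 (Y γ.proj) + t * ξ (Y γ.proj) := by
    funext t
    simp [fibLin]
  rw [h', mfderiv_eq_fderiv] at h
  have h1 : fderiv ℝ (fun t : ℝ ↦ γ.2 (Y γ.proj) + t * ξ (Y γ.proj)) 0 1 = ξ (Y γ.proj) := by
    simp
  have h2 : mvfderiv (cotModel E) (fibLin Y) γ (vertLift γ ξ) = ξ (Y γ.proj) := h.symm.trans h1
  rw [h2]
  simp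

theorem splitting_bijective (D : LinearConnection E M) (γ : CotangentBundle E M) :
    Function.Bijective ((dproj γ).toLinearMap.prod (connector D γ)) := by
  have hsurj : Function.Surjective ((dproj γ).toLinearMap.prod (connector D γ)) := by
    obtain ⟨s, x, hs, rfl⟩ : ∃ (s : OneForm E M) (x : M),
        MDifferentiableAt 𝓘(ℝ, E) (cotModel E) (sectionMap s) x ∧ sectionMap s x = γ :=
      ⟨FiberBundle.extend (E →L[ℝ] ℝ) γ.2, γ.proj, FiberBundle.mdifferentiableAt_extend .., by
        simp [sectionMap]⟩
    rintro ⟨v, ξ⟩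
    let V := mfderiv 𝓘(ℝ, E) (cotModel E) (sectionMap s) x v
    refine ⟨V + vertLift (sectionMap s x) (ξ - connector D (sectionMap s x) V), ?_⟩
    have h1 : dproj (sectionMap s x) V = v := dproj_section hs v
    refine Prod.ext ?_ ?_
    · refine (map_add (dproj (sectionMap s x)) _ _).trans ?_
      rw [h1, dproj_vertical, add_zero]
    · refine (map_add (connector D (sectionMap s x)) _ _).trans ?_
      rw [connector_vertical, add_sub_cancel]
  have hfin : Module.finrank ℝ (TangentSpace (cotModel E) γ)
      = Module.finrank ℝ (GenTangentSpace E γ.proj) := rfl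
  have : FiniteDimensional ℝ (TangentSpace (cotModel E) γ) :=
    inferInstanceAs (FiniteDimensional ℝ (E × (E →L[ℝ] ℝ)))
  have : FiniteDimensional ℝ (GenTangentSpace E γ.proj) :=
    inferInstanceAs (FiniteDimensional ℝ (E × (E →L[ℝ] ℝ)))
  exact ⟨(LinearMap.injective_iff_surjective_of_finrank_eq_finrank hfin).2 hsurj, hsurj⟩

/-- The identification `T_γ(T*M) = H^D_γ ⊕ T^vert_γ(T*M) = T_x M ⊕ T*_x M`, `x = π(γ)`: the first
component of `V` is `dπ(V)`, the second is the vertical part of `V`. -/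
def splitting (D : LinearConnection E M) (γ : CotangentBundle E M) :
    TangentSpace (cotModel E) γ ≃ₗ[ℝ] GenTangentSpace E γ.proj :=
  LinearEquiv.ofBijective _ (splitting_bijective D γ)

/-- The field of endomorphisms `J^{𝒥, D} = π^*(𝒥)` of `T(T*M)` determined by a field of
endomorphisms `𝒥` of `TM ⊕ T*M` and the connection `D`. -/
def inducedEndomorphism (D : LinearConnection E M)
    (𝒥 : Π x : M, GenTangentSpace E x →ₗ[ℝ] GenTangentSpace E x) (γ : CotangentBundle E M) :
    TangentSpace (cotModel E) γ →ₗ[ℝ] TangentSpace (cotModel E) γ :=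
  (splitting D γ).symm.toLinearMap ∘ₗ 𝒥 γ.proj ∘ₗ (splitting D γ).toLinearMap

/-! ### The generalized complex structure of a non-degenerate 2-form -/

theorem NondegenerateTwoForm.bijective (Ω : NondegenerateTwoForm E M) (x : M) :
    Function.Bijective (Ω.form x) := by
  have hinj : Function.Injective (Ω.form x).toLinearMap := by
    rw [injective_iff_map_eq_zero]
    intro v hv
    exact Ω.nondegenerate x v fun w ↦ DFunLike.congr_fun hv w
  have hfin : Module.finrank ℝ (TangentSpace 𝓘(ℝ, E) x)
      = Module.finrank ℝ (TangentSpace 𝓘(ℝ, E) x →L[ℝ] ℝ) := by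
    rw [← (LinearMap.toContinuousLinearMap (𝕜 := ℝ) (E := TangentSpace 𝓘(ℝ, E) x)
      (F' := ℝ)).finrank_eq]
    exact (Subspace.dual_finrank_eq (K := ℝ) (V := TangentSpace 𝓘(ℝ, E) x)).symm
  have : FiniteDimensional ℝ (TangentSpace 𝓘(ℝ, E) x →L[ℝ] ℝ) :=
    inferInstanceAs (FiniteDimensional ℝ (E →L[ℝ] ℝ))
  exact ⟨hinj, (LinearMap.injective_iff_surjective_of_finrank_eq_finrank hfin).1 hinj⟩

/-- `Ω` as an isomorphism `T_x M → T*_x M`, `v ↦ Ω(v, ·)`. -/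
def NondegenerateTwoForm.toEquiv (Ω : NondegenerateTwoForm E M) (x : M) :
    TangentSpace 𝓘(ℝ, E) x ≃ₗ[ℝ] (TangentSpace 𝓘(ℝ, E) x →L[ℝ] ℝ) :=
  LinearEquiv.ofBijective (Ω.form x).toLinearMap (Ω.bijective x)

/-- The generalized complex structure `𝒥^Ω (v + ξ) = Ω⁻¹(ξ) - Ω(v, ·)`. -/
def NondegenerateTwoForm.genComplex (Ω : NondegenerateTwoForm E M) (x : M) :
    GenTangentSpace E x →ₗ[ℝ] GenTangentSpace E x :=
  LinearMap.prod
    ((Ω.toEquiv x).symm.toLinearMap ∘ₗ LinearMap.snd ℝ _ _)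
    (-((Ω.toEquiv x).toLinearMap ∘ₗ LinearMap.fst ℝ _ _))

theorem inducedEndomorphism_sq (D : LinearConnection E M) (Ω : NondegenerateTwoForm E M)
    (γ : CotangentBundle E M) (V : TangentSpace (cotModel E) γ) :
    inducedEndomorphism D Ω.genComplex γ (inducedEndomorphism D Ω.genComplex γ V) = -V := by
  apply (splitting D γ).injective
  rw [map_neg]
  simp [inducedEndomorphism, NondegenerateTwoForm.genComplex]
  rfl

end Splitting

/-! ### Integrability of an almost complex structure -/

section Integrability

variable {F : Type*} [NormedAddCommGroup F] [NormedSpace ℝ F] {H : Type*} [TopologicalSpace H]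
  (I : ModelWithCorners ℝ F H) {N : Type*} [TopologicalSpace N] [ChartedSpace H N]

/-- A complex vector field on `N`, i.e. a section of the complexified tangent bundle, given by its
real and imaginary parts. -/
structure ComplexField where
  /-- The real part. -/
  re : Π p : N, TangentSpace I p
  /-- The imaginary part. -/
  im : Π p : N, TangentSpace I p

variable {I}

open VectorField in
/-- The complex bilinear extension of the Lie bracket:
`[A + iB, A' + iB'] = [A, A'] - [B, B'] + i([A, B'] + [B, A'])`. -/
def ComplexField.bracket (U V : ComplexField I (N := N)) : ComplexField I (N := N) where
  re p := mlieBracket I U.re V.re p - mlieBracket I U.im V.im p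
  im p := mlieBracket I U.re V.im p + mlieBracket I U.im V.re p

/-- `U = A + iB` is a section of the holomorphic bundle of `J`, the `i`-eigenbundle of the complex
linear extension of `J`: `J(A) + i J(B) = i (A + iB)`. -/
def ComplexField.IsHolomorphicSection (J : Π p : N, TangentSpace I p →ₗ[ℝ] TangentSpace I p)
    (U : ComplexField I (N := N)) : Prop :=
  ∀ p, J p (U.re p) = -U.im p ∧ J p (U.im p) = U.re p

/-- The complex vector field `U` is smooth. -/
def ComplexField.Smooth [IsManifold I ∞ N] (U : ComplexField I (N := N)) : Prop :=
  ContMDiff I (I.prod 𝓘(ℝ, F)) ∞ (fun p ↦ (TotalSpace.mk' F p (U.re p) : TangentBundle I N)) ∧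
  ContMDiff I (I.prod 𝓘(ℝ, F)) ∞ (fun p ↦ (TotalSpace.mk' F p (U.im p) : TangentBundle I N))

/-- The almost complex structure `J` is integrable: its holomorphic bundle is involutive, i.e. the
space of its smooth sections is closed under the Lie bracket. -/
def IsIntegrable [IsManifold I ∞ N] (J : Π p : N, TangentSpace I p →ₗ[ℝ] TangentSpace I p) : Prop :=
  ∀ U V : ComplexField I (N := N), U.Smooth → V.Smooth →
    U.IsHolomorphicSection J → V.IsHolomorphicSection J → (U.bracket V).IsHolomorphicSection J

end Integrability

end CotangentGeometry

/-! ### The Lie bracket as a commutator of derivations. -/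

namespace CotangentGeometry
section Derivation

open VectorField Set Filter
open scoped Topology

variable {F : Type*} [NormedAddCommGroup F] [NormedSpace ℝ F]
  {G : Type*} [NormedAddCommGroup G] [NormedSpace ℝ G]

/-! Write `X^h` for the horizontal lift of a vector field and `ξ^v` for the vertical lift of a
1-form. Since `J(X^h) = -Ω(X, ·)^v`, the fields `X^h + i Ω(X, ·)^v` (`holomorphicLift`) are
holomorphic sections, and those coming from a local frame of `M` span the holomorphic bundle over
complex functions.

For holomorphic `U`, `V` put `N(U, V) = J Re[U, V] + Im[U, V]` (`ComplexField.defect`). As `J² =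
-1`, the bracket is holomorphic exactly when `N(U, V) = 0`. Like a Nijenhuis tensor, `N` is
antisymmetric, linear over real functions in holomorphic sections, and turns `i` into `-J`. Hence
integrability need only be tested on the special sections.

Their brackets follow from `connector_mlieBracket_lift`: vertical lifts commute, `[X^h, ξ^v] = (D_X
ξ)^v`, and `[X^h, Y^h]` is `[X, Y]^h` plus the vertical lift of `-γ ∘ R_{X,Y}` at `γ`. So `N = 0` on
two special sections says that `γ(R_{X,Y} Z) = 0` and `Ω([X, Y], ·) = D_X(ΩY) - D_Y(ΩX)`. Letting
`γ` vary, the first is flatness; by `extDeriv_sub_covDeriv_sub_torsion` the second is the condition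
on `dΩ`.

The brackets are computed by differentiating two kinds of functions on `T*M`: functions pulled back
from `M` and the fibrewise linear functions `fibLin Z`. Together these detect tangent vectors and
smoothness. -/

theorem fderiv_lieBracket {f : F → G} {A B : F → F} {y : F} (hf : ContDiffAt ℝ 2 f y)
    (hA : DifferentiableAt ℝ A y) (hB : DifferentiableAt ℝ B y) :
    fderiv ℝ f y (lieBracket ℝ A B y) =
      fderiv ℝ (fun z ↦ fderiv ℝ f z (B z)) y (A y)
        - fderiv ℝ (fun z ↦ fderiv ℝ f z (A z)) y (B y) := by
  have hf' : DifferentiableAt ℝ (fderiv ℝ f) y :=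
    (hf.fderiv_right (m := 1) (by norm_num)).differentiableAt one_ne_zero
  -- The second-order terms of the commutator cancel by symmetry of the second derivative.
  have hsymm : IsSymmSndFDerivAt ℝ f y := hf.isSymmSndFDerivAt (by simp)
  rw [fderiv_clm_apply hf' hB, fderiv_clm_apply hf' hA]
  simp [lieBracket, hsymm.eq (A y) (B y)]

variable {H : Type*} [TopologicalSpace H]
  {I : ModelWithCorners ℝ F H} {N : Type*} [TopologicalSpace N] [ChartedSpace H N]
  [IsManifold I ∞ N]

theorem mvfderiv_eq_of_eventuallyEq_comp_extChartAt {g : N → G} {p q : N} {h : F → G}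
    (hq : q ∈ (chartAt H p).source) (hg : g =ᶠ[𝓝 q] h ∘ extChartAt I p)
    (hh : DifferentiableAt ℝ h (extChartAt I p q)) (v : TangentSpace I q) :
    mvfderiv I g q v
      = fderiv ℝ h (extChartAt I p q) (mfderiv I 𝓘(ℝ, F) (extChartAt I p) q v) := by
  have h1 : mfderiv I 𝓘(ℝ, G) g q = mfderiv I 𝓘(ℝ, G) (h ∘ extChartAt I p) q := hg.mfderiv_eq
  have h2 := mfderiv_comp q hh.mdifferentiableAt (mdifferentiableAt_extChartAt hq (I := I))
  rw [mfderiv_eq_fderiv] at h2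
  rw [h2] at h1
  exact DFunLike.congr_fun h1 v

/-- The differentials of a chart and of its inverse are mutually inverse. This matches the
derivative of a function along `C` with the pullback of `C` through which `mlieBracket` is defined.
-/
theorem mfderiv_extChartAt_eq_mpullbackWithin (C : Π p : N, TangentSpace I p) {p q : N}
    (hq : q ∈ (extChartAt I p).source) :
    mfderiv I 𝓘(ℝ, F) (extChartAt I p) q (C q)
      = mpullbackWithin 𝓘(ℝ, F) I (extChartAt I p).symm C (range I) (extChartAt I p q) := by
  obtain ⟨y, hy, rfl⟩ : ∃ y ∈ (extChartAt I p).target, (extChartAt I p).symm y = q :=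
    ⟨extChartAt I p q, (extChartAt I p).map_source hq, (extChartAt I p).left_inv hq⟩
  rw [(extChartAt I p).right_inv hy, mpullbackWithin_apply]
  obtain ⟨e, he⟩ := isInvertible_mfderivWithin_extChartAt_symm hy
  have h := mfderiv_extChartAt_comp_mfderivWithin_extChartAt_symm hy
  have h' := DFunLike.congr_fun h (e.symm (C ((extChartAt I p).symm y)))
  rw [← he] at h' ⊢
  rw [ContinuousLinearMap.inverse_equiv]
  refine Eq.trans ?_ h'
  exact congrArg (mfderiv I 𝓘(ℝ, F) (extChartAt I p) ((extChartAt I p).symm y))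
    (e.apply_symm_apply _).symm

variable [I.Boundaryless] [CompleteSpace F]

/-- A Lie bracket acts on functions as the commutator of derivations. -/
theorem mvfderiv_mlieBracket {f : N → G} {A B : Π p : N, TangentSpace I p} {p : N}
    (hf : ContMDiffAt I 𝓘(ℝ, G) 2 f p)
    (hA : MDifferentiableAt I I.tangent (fun q ↦ (TotalSpace.mk' F q (A q) : TangentBundle I N)) p)
    (hB : MDifferentiableAt I I.tangent (fun q ↦ (TotalSpace.mk' F q (B q) : TangentBundle I N)) p) :
    mvfderiv I f p (mlieBracket I A B p) =
      mvfderiv I (fun q ↦ mvfderiv I f q (B q)) p (A p)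
        - mvfderiv I (fun q ↦ mvfderiv I f q (A q)) p (B p) := by
  set φ := extChartAt I p with hφ
  have : IsManifold I 2 N := IsManifold.of_le (n := ∞) (by norm_cast)
  have hp : p ∈ (chartAt H p).source := mem_chart_source H p
  let f' : F → G := f ∘ φ.symm
  let lift (C : Π p : N, TangentSpace I p) : F → F :=
    mpullbackWithin 𝓘(ℝ, F) I φ.symm C (range I)
  have hf' : ContDiffAt ℝ 2 f' (φ p) := by
    have h := (contMDiffAt_iff.1 hf).2
    rw [I.range_eq_univ, contDiffWithinAt_univ] at h
    exact h
  have hev (q : N) (hq : q ∈ φ.source) : f =ᶠ[𝓝 q] f' ∘ φ := by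
    filter_upwards [(isOpen_extChartAt_source p).mem_nhds hq] with r hr
    exact congrArg f (φ.left_inv hr).symm
  have hf'' : ∀ᶠ q in 𝓝 p, DifferentiableAt ℝ f' (φ q) := by
    have h := (hf'.eventually (by simp)).mono fun y hy ↦
      ContDiffAt.differentiableAt hy two_ne_zero
    exact (continuousAt_extChartAt p).eventually h
  -- The function `C(f)`, read in the chart, is the derivative of `f'` along the coordinate
  -- expression of `C`. The identity is needed near `p` because it is differentiated again.
  have key (C : Π p : N, TangentSpace I p) :
      (fun q ↦ mvfderiv I f q (C q)) =ᶠ[𝓝 p] (fun y ↦ fderiv ℝ f' y (lift C y)) ∘ φ := by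
    filter_upwards [hf'', (isOpen_extChartAt_source p).mem_nhds (mem_extChartAt_source (I := I) p)]
      with q hq hq'
    rw [mvfderiv_eq_of_eventuallyEq_comp_extChartAt (by simpa [hφ] using hq') (hev q hq') hq,
      mfderiv_extChartAt_eq_mpullbackWithin C hq']
    rfl
  have hdiff (C : Π p : N, TangentSpace I p) (hC : MDifferentiableAt I I.tangent
      (fun q ↦ (TotalSpace.mk' F q (C q) : TangentBundle I N)) p) :
      DifferentiableAt ℝ (lift C) (φ p) := by
    have h := (hC.mdifferentiableWithinAt
      (s := univ)).differentiableWithinAt_mpullbackWithin_vectorField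
    have h' : DifferentiableWithinAt ℝ (lift C) univ (φ p) := by
      rw [preimage_univ, univ_inter] at h
      exact h.mono_of_mem_nhdsWithin (by simp [I.range_eq_univ])
    exact differentiableWithinAt_univ.1 h'
  have hdiff' (C : Π p : N, TangentSpace I p) (hC : MDifferentiableAt I I.tangent
      (fun q ↦ (TotalSpace.mk' F q (C q) : TangentBundle I N)) p) :
      DifferentiableAt ℝ (fun y ↦ fderiv ℝ f' y (lift C y)) (φ p) :=
    ((hf'.fderiv_right (m := 1) (by norm_num)).differentiableAt one_ne_zero).clm_apply (hdiff C hC)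
  have hbr : mfderiv I 𝓘(ℝ, F) φ p (mlieBracket I A B p)
      = lieBracket ℝ (lift A) (lift B) (φ p) := by
    have hs : φ.symm ⁻¹' univ ∩ range I = univ := by rw [I.range_eq_univ]; simp
    have hw : lieBracketWithin ℝ (lift A) (lift B) (φ.symm ⁻¹' univ ∩ range I) (φ p)
        = lieBracket ℝ (lift A) (lift B) (φ p) := by rw [hs, lieBracketWithin_univ]
    rw [← hw]
    set w : F := lieBracketWithin ℝ (lift A) (lift B) (φ.symm ⁻¹' univ ∩ range I) (φ p)
    have h : mlieBracket I A B p = (mfderiv I 𝓘(ℝ, F) φ p).inverse w :=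
      mlieBracketWithin_apply
    rw [h]
    obtain ⟨e, he⟩ := isInvertible_mfderiv_extChartAt (I := I) (mem_extChartAt_source p)
    rw [hφ, ← he, ContinuousLinearMap.inverse_equiv]
    exact e.apply_symm_apply _
  rw [mvfderiv_eq_of_eventuallyEq_comp_extChartAt hp (hev p (mem_extChartAt_source p))
      (hf'.differentiableAt two_ne_zero), hbr, fderiv_lieBracket hf' (hdiff A hA) (hdiff B hB),
    mvfderiv_eq_of_eventuallyEq_comp_extChartAt hp (key B) (hdiff' B hB),
    mvfderiv_eq_of_eventuallyEq_comp_extChartAt hp (key A) (hdiff' A hA),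
    mfderiv_extChartAt_eq_mpullbackWithin A (mem_extChartAt_source p),
    mfderiv_extChartAt_eq_mpullbackWithin B (mem_extChartAt_source p)]

end Derivation
end CotangentGeometry

/-! ### Global test fields and a smoothness criterion on `T*M`. -/

namespace CotangentGeometry
section Smoothness

open VectorField Set Filter
open scoped Topology

theorem contMDiffAt_clm_of_apply {E₁ : Type*} [NormedAddCommGroup E₁] [NormedSpace ℝ E₁]
    [FiniteDimensional ℝ E₁] {F : Type*} [NormedAddCommGroup F] [NormedSpace ℝ F]
    {H : Type*} [TopologicalSpace H] {I : ModelWithCorners ℝ F H} {N : Type*} [TopologicalSpace N]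
    [ChartedSpace H N] {L : N → E₁ →L[ℝ] ℝ} {p : N} {n : ℕ∞ω}
    (h : ∀ e, ContMDiffAt I 𝓘(ℝ, ℝ) n (fun q ↦ L q e) p) :
    ContMDiffAt I 𝓘(ℝ, E₁ →L[ℝ] ℝ) n L p := by
  let b := Module.finBasis ℝ E₁
  have hL : L = fun q ↦ ∑ i, L q (b i) • (b.coord i).toContinuousLinearMap := by
    funext q
    refine ContinuousLinearMap.coe_injective (b.ext fun j ↦ ?_)
    simp [Finsupp.single_apply]
  rw [hL]
  exact contMDiffAt_finsetSum fun i _ ↦ (h (b i)).smul contMDiffAt_const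

theorem mfderiv_clm_comp {F : Type*} [NormedAddCommGroup F] [NormedSpace ℝ F]
    {H : Type*} [TopologicalSpace H] {I : ModelWithCorners ℝ F H} {N : Type*} [TopologicalSpace N]
    [ChartedSpace H N] {F' G : Type*} [NormedAddCommGroup F'] [NormedSpace ℝ F']
    [NormedAddCommGroup G] [NormedSpace ℝ G] (L : F' →L[ℝ] G) {φ : N → F'} {q : N}
    (hφ : MDifferentiableAt I 𝓘(ℝ, F') φ q) (v : TangentSpace I q) :
    mvfderiv I (fun q ↦ L (φ q)) q v = L (mvfderiv I φ q v) := by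
  have h := mfderiv_comp q L.mdifferentiableAt hφ
  rw [L.mfderiv_eq] at h
  exact DFunLike.congr_fun h v

variable {E : Type*} [NormedAddCommGroup E] [NormedSpace ℝ E]
  {M : Type*} [TopologicalSpace M] [ChartedSpace E M] [IsManifold 𝓘(ℝ, E) ∞ M]

theorem SmoothField.mdifferentiableAt {Y : VField E M} (hY : SmoothField Y) (x : M) :
    MDifferentiableAt 𝓘(ℝ, E) (𝓘(ℝ, E).prod 𝓘(ℝ, E))
      (fun x ↦ (TotalSpace.mk' E x (Y x) : TangentBundle 𝓘(ℝ, E) M)) x :=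
  (ContMDiff.contMDiffAt hY).mdifferentiableAt (by simp)

/-- A bump function supported in the trivialization domain extends the local section with constant
coordinates `w` by zero. -/
theorem exists_smoothField_eventuallyEq [T2Space M] [FiniteDimensional ℝ E] (x : M) (w : E) :
    ∃ Y : VField E M, SmoothField Y ∧
      ∀ᶠ y in 𝓝 x, Y y = (trivializationAt E (TangentSpace 𝓘(ℝ, E)) x).symm y w := by
  let t := trivializationAt E (TangentSpace 𝓘(ℝ, E) : M → Type _) x
  have ht : t.baseSet ∈ 𝓝 x :=
    t.open_baseSet.mem_nhds (FiberBundle.mem_baseSet_trivializationAt' x)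
  obtain ⟨ψ, hψ⟩ : ∃ ψ : SmoothBumpFunction 𝓘(ℝ, E) x, tsupport ψ ⊆ t.baseSet := by
    obtain ⟨ψ, -, h⟩ := (SmoothBumpFunction.nhds_basis_tsupport (I := 𝓘(ℝ, E)) x).mem_iff.1 ht
    exact ⟨ψ, h⟩
  refine ⟨(ψ : M → ℝ) • fun y ↦ t.symm y w, ?_, ?_⟩
  · refine ContMDiffOn.smul_section_of_tsupport (u := t.baseSet) ψ.contMDiff.contMDiffOn
      t.open_baseSet hψ ?_
    rw [t.contMDiffOn_section_baseSet_iff]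
    refine (contMDiffOn_const (c := w)).congr fun y hy ↦ ?_
    simp [hy]
  · filter_upwards [ψ.eventuallyEq_one] with y hy
    simp [hy, t]

theorem exists_smoothField_eq [T2Space M] [FiniteDimensional ℝ E] {x : M}
    (v : TangentSpace 𝓘(ℝ, E) x) : ∃ Y : VField E M, SmoothField Y ∧ Y x = v := by
  let t := trivializationAt E (TangentSpace 𝓘(ℝ, E) : M → Type _) x
  obtain ⟨Y, hY, h⟩ := exists_smoothField_eventuallyEq x (t ⟨x, v⟩).2
  refine ⟨Y, hY, h.self_of_nhds.trans ?_⟩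
  -- `FiberBundle.extend` is itself the section with the constant coordinates of `v`, so its value
  -- at `x` is the one required.
  exact FiberBundle.extend_apply_self E v

theorem contMDiff_dproj {A : Π γ : CotangentBundle E M, TangentSpace (cotModel E) γ}
    (hA : ContMDiff (cotModel E) (cotModel E).tangent ∞
      (fun γ ↦ (TotalSpace.mk' (E × (E →L[ℝ] ℝ)) γ (A γ) :
        TangentBundle (cotModel E) (CotangentBundle E M)))) :
    ContMDiff (cotModel E) (𝓘(ℝ, E).prod 𝓘(ℝ, E)) ∞ (fun γ : CotangentBundle E M ↦
      (TotalSpace.mk' E γ.proj (dproj γ (A γ)) : TangentBundle 𝓘(ℝ, E) M)) := by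
  have h : ContMDiff (cotModel E) 𝓘(ℝ, E) ∞ (fun γ : CotangentBundle E M ↦ γ.proj) :=
    contMDiff_proj _
  exact (h.contMDiff_tangentMap (m := ∞) (by norm_cast)).comp hA

/-- The chart of `T*M` at `γ₀` consists of base coordinates and fibre coordinates, and near `γ₀` the
latter are functions `fibLin Y` for fields `Y` with constant coordinates. The components of `A` are
the derivatives of these functions along `A`. -/
theorem contMDiff_of_dproj_of_fibLin [T2Space M] [FiniteDimensional ℝ E]
    {A : Π γ : CotangentBundle E M, TangentSpace (cotModel E) γ}
    (h1 : ContMDiff (cotModel E) (𝓘(ℝ, E).prod 𝓘(ℝ, E)) ∞ (fun γ : CotangentBundle E M ↦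
      (TotalSpace.mk' E γ.proj (dproj γ (A γ)) : TangentBundle 𝓘(ℝ, E) M)))
    (h2 : ∀ Y : VField E M, SmoothField Y → ContMDiff (cotModel E) 𝓘(ℝ, ℝ) ∞
      (fun γ ↦ mvfderiv (cotModel E) (fibLin Y) γ (A γ))) :
    ContMDiff (cotModel E) (cotModel E).tangent ∞
      (fun γ ↦ (TotalSpace.mk' (E × (E →L[ℝ] ℝ)) γ (A γ) :
        TangentBundle (cotModel E) (CotangentBundle E M))) := by
  intro γ₀
  refine (contMDiffAt_section _).2 ?_
  let φ := extChartAt (cotModel E) γ₀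
  let x₀ := γ₀.proj
  let W : CotangentBundle E M → E × (E →L[ℝ] ℝ) := fun γ ↦ mvfderiv (cotModel E) φ γ (A γ)
  have hsrc : ∀ᶠ γ in 𝓝 γ₀, γ ∈ (chartAt (ModelProd E (E →L[ℝ] ℝ)) γ₀).source :=
    (chartAt (ModelProd E (E →L[ℝ] ℝ)) γ₀).open_source.mem_nhds (mem_chart_source _ γ₀)
  have hW : (fun γ ↦ (trivializationAt (E × (E →L[ℝ] ℝ)) (TangentSpace (cotModel E)) γ₀
      ⟨γ, A γ⟩).2) =ᶠ[𝓝 γ₀] W := by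
    filter_upwards [hsrc] with γ hγ
    have h := DFunLike.congr_fun
      (TangentBundle.continuousLinearMapAt_trivializationAt (𝕜 := ℝ) (I := cotModel E) hγ) (A γ)
    refine Eq.trans ?_ h
    rw [Trivialization.continuousLinearMapAt_apply, Trivialization.linearMapAt_apply]
    rw [if_pos (by simpa using hγ)]
  refine ContMDiffAt.congr_of_eventuallyEq ?_ hW
  have hφ : ∀ᶠ γ in 𝓝 γ₀, MDifferentiableAt (cotModel E) 𝓘(ℝ, E × (E →L[ℝ] ℝ)) φ γ := by
    filter_upwards [hsrc] with γ hγ using mdifferentiableAt_extChartAt hγ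
  have hW1 : ContMDiffAt (cotModel E) 𝓘(ℝ, E) ∞ (fun γ ↦ (W γ).1) γ₀ := by
    refine (contMDiffAt_totalSpace.1 (h1 γ₀)).2.congr_of_eventuallyEq ?_
    have hs : ∀ᶠ γ : CotangentBundle E M in 𝓝 γ₀, γ.proj ∈ (chartAt E x₀).source :=
      (FiberBundle.continuous_proj (E →L[ℝ] ℝ) _).continuousAt.eventually
        ((chartAt E x₀).open_source.mem_nhds (mem_chart_source E x₀))
    filter_upwards [hφ, hsrc, hs] with γ hγ hγ' hγs
    have h := mfderiv_clm_comp (ContinuousLinearMap.fst ℝ E (E →L[ℝ] ℝ)) hγ (A γ)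
    have h' := mfderiv_comp_apply (I' := 𝓘(ℝ, E)) γ
      (mdifferentiableAt_extChartAt (I := 𝓘(ℝ, E)) hγs) (mdifferentiableAt_dproj γ) (A γ)
    have h'' := DFunLike.congr_fun
      (TangentBundle.continuousLinearMapAt_trivializationAt (𝕜 := ℝ) (I := 𝓘(ℝ, E)) hγs)
      (dproj γ (A γ))
    rw [Trivialization.continuousLinearMapAt_apply, Trivialization.linearMapAt_apply,
      if_pos (by simpa using hγs)] at h''
    refine h.symm.trans (Eq.trans ?_ h''.symm)
    refine Eq.trans ?_ h'
    have hfun : (fun q ↦ ContinuousLinearMap.fst ℝ E (E →L[ℝ] ℝ) (φ q))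
      = (extChartAt 𝓘(ℝ, E) x₀) ∘ fun γ : CotangentBundle E M ↦ γ.proj := by
      funext q
      simp only [φ, FiberBundle.extChartAt]
      rfl
    rw [hfun]
    rfl
  have hW2 : ContMDiffAt (cotModel E) 𝓘(ℝ, E →L[ℝ] ℝ) ∞ (fun γ ↦ (W γ).2) γ₀ := by
    refine contMDiffAt_clm_of_apply fun e ↦ ?_
    obtain ⟨Y, hY, hYe⟩ := exists_smoothField_eventuallyEq x₀ e
    refine (h2 Y hY γ₀).congr_of_eventuallyEq ?_
    -- Derivatives at each nearby `γ` are compared, so the functions must agree on a neighbourhood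
    -- of that `γ`.
    have hs : ∀ᶠ γ : CotangentBundle E M in 𝓝 γ₀, ∀ᶠ γ' in 𝓝 γ,
        γ'.proj ∈ (trivializationAt E (TangentSpace 𝓘(ℝ, E)) x₀).baseSet ∧
        Y γ'.proj = (trivializationAt E (TangentSpace 𝓘(ℝ, E)) x₀).symm γ'.proj e := by
      have hb := (trivializationAt E (TangentSpace 𝓘(ℝ, E)) x₀).open_baseSet.mem_nhds
        (FiberBundle.mem_baseSet_trivializationAt' x₀)
      have hc : ContinuousAt (fun γ : CotangentBundle E M ↦ γ.proj) γ₀ :=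
        (FiberBundle.continuous_proj (E →L[ℝ] ℝ) _).continuousAt
      exact (hc.eventually (Filter.Eventually.and hb hYe)).eventually_nhds
    filter_upwards [hφ, hs] with γ hγ hγs
    have h := mfderiv_clm_comp ((ContinuousLinearMap.apply ℝ ℝ e) ∘L
      (ContinuousLinearMap.snd ℝ E (E →L[ℝ] ℝ))) hγ (A γ)
    refine h.symm.trans ?_
    have hev : (fun q ↦ ((ContinuousLinearMap.apply ℝ ℝ e) ∘L
      (ContinuousLinearMap.snd ℝ E (E →L[ℝ] ℝ))) (φ q)) =ᶠ[𝓝 γ] fibLin Y := by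
      filter_upwards [hγs] with q ⟨hq, hq'⟩
      simp only [φ, FiberBundle.extChartAt]
      simp [fibLin, hq', hom_trivializationAt_apply, ContinuousLinearMap.inCoordinates]
      exact congrArg q.snd (Trivialization.symmL_apply (R := ℝ)
        (trivializationAt E (TangentSpace 𝓘(ℝ, E)) x₀) hq e)
    exact DFunLike.congr_fun hev.mfderiv_eq (A γ)
  exact hW1.prodMk_space hW2

end Smoothness
end CotangentGeometry

/-! ### Lifts to `T*M` and their brackets. -/

namespace CotangentGeometry
section Lift

open VectorField Set Filter
open scoped Topology

variable {E : Type*} [NormedAddCommGroup E] [NormedSpace ℝ E]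
  {M : Type*} [TopologicalSpace M] [ChartedSpace E M] [IsManifold 𝓘(ℝ, E) ∞ M]

/-- A vector field on the cotangent manifold is smooth. -/
def SmoothLiftField (A : Π γ : CotangentBundle E M, TangentSpace (cotModel E) γ) : Prop :=
  ContMDiff (cotModel E) (cotModel E).tangent ∞
    (fun γ ↦ (TotalSpace.mk' (E × (E →L[ℝ] ℝ)) γ (A γ) :
      TangentBundle (cotModel E) (CotangentBundle E M)))

/-- The 1-form `ξ` is smooth, tested on smooth vector fields. -/
def SmoothOneForm (ξ : OneForm E M) : Prop :=
  ∀ Y : VField E M, SmoothField Y → ContMDiff 𝓘(ℝ, E) 𝓘(ℝ, ℝ) ∞ (fun x ↦ ξ x (Y x))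

theorem contMDiff_cotangent_proj :
    ContMDiff (cotModel E) 𝓘(ℝ, E) ∞ (fun γ : CotangentBundle E M ↦ γ.proj) :=
  contMDiff_proj _

theorem SmoothField.contMDiff_fibLin {Y : VField E M} (hY : SmoothField Y) :
    ContMDiff (cotModel E) 𝓘(ℝ, ℝ) ∞ (fibLin Y) := by
  intro γ
  have h2 := (ContMDiff.comp hY contMDiff_cotangent_proj) γ
  -- The identity of `T*M`, read as the tautological covector field along `π`.
  have h1 : ContMDiffAt (cotModel E) (cotModel E) ∞
    (fun γ : CotangentBundle E M ↦ TotalSpace.mk' (E →L[ℝ] ℝ)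
      (E := fun x : M ↦ TangentSpace 𝓘(ℝ, E) x →L[ℝ] ℝ) γ.proj γ.2) γ := contMDiffAt_id
  have h3 := ContMDiffAt.clm_bundle_apply (F₁ := E) (F₂ := ℝ)
    (E₁ := fun x : M ↦ TangentSpace 𝓘(ℝ, E) x) (E₂ := Trivial M ℝ)
    (b := fun γ : CotangentBundle E M ↦ γ.proj) (ϕ := fun γ ↦ γ.2) (v := fun γ ↦ Y γ.proj) h1 h2
  exact (contMDiffAt_totalSpace.1 h3).2

theorem SmoothField.covField {D : LinearConnection E M} [D.ContMDiffCovariantDerivative ∞]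
    {X Y : VField E M} (hX : SmoothField X) (hY : SmoothField Y) : SmoothField (covField D X Y) := by
  have h := (CovariantDerivative.ContMDiffCovariantDerivative.contMDiff (cov := D) (k := ∞)).contMDiff
    (σ := Y) (ContMDiff.contMDiffOn hY)
  rw [contMDiffOn_univ] at h
  exact h.clm_bundle_apply hX

theorem SmoothField.contMDiffAt_mvfderiv_extChartAt {X : VField E M} (hX : SmoothField X) (x : M) :
    ContMDiffAt 𝓘(ℝ, E) 𝓘(ℝ, E) ∞
      (fun y ↦ mvfderiv 𝓘(ℝ, E) (extChartAt 𝓘(ℝ, E) x) y (X y)) x := by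
  refine ((contMDiffAt_section _).1 (hX x)).congr_of_eventuallyEq ?_
  filter_upwards [(chartAt E x).open_source.mem_nhds (mem_chart_source E x)] with y hy
  have h := DFunLike.congr_fun
    (TangentBundle.continuousLinearMapAt_trivializationAt (𝕜 := ℝ) (I := 𝓘(ℝ, E)) hy) (X y)
  rw [Trivialization.continuousLinearMapAt_apply, Trivialization.linearMapAt_apply,
    if_pos (by simpa using hy)] at h
  exact h.symm

theorem SmoothLiftField.mdifferentiableAt
    {A : Π γ : CotangentBundle E M, TangentSpace (cotModel E) γ} (hA : SmoothLiftField A)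
    (γ : CotangentBundle E M) : MDifferentiableAt (cotModel E) (cotModel E).tangent
    (fun γ ↦ (TotalSpace.mk' (E × (E →L[ℝ] ℝ)) γ (A γ) :
      TangentBundle (cotModel E) (CotangentBundle E M))) γ :=
  (hA γ).mdifferentiableAt (by simp)

theorem mvfderiv_comp_proj {G : Type*} [NormedAddCommGroup G] [NormedSpace ℝ G] {g : M → G}
    {γ : CotangentBundle E M} (hg : MDifferentiableAt 𝓘(ℝ, E) 𝓘(ℝ, G) g γ.proj)
    (v : TangentSpace (cotModel E) γ) :
    mvfderiv (cotModel E) (fun γ : CotangentBundle E M ↦ g γ.proj) γ v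
      = mvfderiv 𝓘(ℝ, E) g γ.proj (dproj γ v) :=
  mfderiv_comp_apply γ hg (mdifferentiableAt_dproj γ) v

variable [FiniteDimensional ℝ E]

/-- Lie brackets of projectable vector fields are projectable. -/
theorem dproj_mlieBracket {A B : Π γ : CotangentBundle E M, TangentSpace (cotModel E) γ}
    {X Y : VField E M} (hA : SmoothLiftField A) (hB : SmoothLiftField B)
    (hX : SmoothField X) (hY : SmoothField Y)
    (hAX : ∀ γ, dproj γ (A γ) = X γ.proj) (hBY : ∀ γ, dproj γ (B γ) = Y γ.proj)
    (γ : CotangentBundle E M) :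
    dproj γ (mlieBracket (cotModel E) A B γ) = mlieBracket 𝓘(ℝ, E) X Y γ.proj := by
  have : CompleteSpace E := FiniteDimensional.complete ℝ E
  let φ := extChartAt 𝓘(ℝ, E) γ.proj
  have hφ : ContMDiffAt 𝓘(ℝ, E) 𝓘(ℝ, E) ∞ φ γ.proj := contMDiffAt_extChartAt
  -- A chart has identity differential at its own centre, so the derivative of the vector-valued
  -- function `φ` returns the tangent vector itself. It remains to compare the commutator formula
  -- for `φ ∘ π` with that for `φ`.
  have hdφ (v : TangentSpace 𝓘(ℝ, E) γ.proj) : mvfderiv 𝓘(ℝ, E) φ γ.proj v = v :=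
    DFunLike.congr_fun (mfderiv_extChartAt_self (𝕜 := ℝ) (I := 𝓘(ℝ, E)) (x := γ.proj)) v
  have hev (C : Π γ : CotangentBundle E M, TangentSpace (cotModel E) γ) (Z : VField E M)
      (hCZ : ∀ γ, dproj γ (C γ) = Z γ.proj) :
      (fun q ↦ mvfderiv (cotModel E) (fun γ : CotangentBundle E M ↦ φ γ.proj) q (C q))
        =ᶠ[𝓝 γ] fun q ↦ mvfderiv 𝓘(ℝ, E) φ q.proj (Z q.proj) := by
    have hs : ∀ᶠ q : CotangentBundle E M in 𝓝 γ, q.proj ∈ (chartAt E γ.proj).source :=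
      (FiberBundle.continuous_proj (E →L[ℝ] ℝ) _).continuousAt.eventually
        ((chartAt E γ.proj).open_source.mem_nhds (mem_chart_source E γ.proj))
    filter_upwards [hs] with q hq
    rw [mvfderiv_comp_proj (mdifferentiableAt_extChartAt hq), hCZ]
  have hφA := mvfderiv_mlieBracket (p := γ) (f := fun γ : CotangentBundle E M ↦ φ γ.proj)
    ((ContMDiffAt.comp γ hφ (contMDiff_cotangent_proj γ)).of_le (by norm_cast))
    (hA.mdifferentiableAt γ) (hB.mdifferentiableAt γ)
  have hφX := mvfderiv_mlieBracket (p := γ.proj) (hφ.of_le (by norm_cast))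
    (hX.mdifferentiableAt γ.proj) (hY.mdifferentiableAt γ.proj)
  have hcomp (C : Π γ : CotangentBundle E M, TangentSpace (cotModel E) γ) (Z : VField E M)
      (hCZ : ∀ γ, dproj γ (C γ) = Z γ.proj) (hZ : SmoothField Z) (v : TangentSpace (cotModel E) γ) :
      mvfderiv (cotModel E)
        (fun q ↦ mvfderiv (cotModel E) (fun γ : CotangentBundle E M ↦ φ γ.proj) q (C q)) γ v
        = mvfderiv 𝓘(ℝ, E) (fun x ↦ mvfderiv 𝓘(ℝ, E) φ x (Z x)) γ.proj (dproj γ v) := by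
    refine (DFunLike.congr_fun (hev C Z hCZ).mfderiv_eq v).trans ?_
    exact mvfderiv_comp_proj
      ((hZ.contMDiffAt_mvfderiv_extChartAt γ.proj).mdifferentiableAt (by simp)) v
  rw [hcomp B Y hBY hY, hcomp A X hAX hX, hAX, hBY, ← hφX,
    mvfderiv_comp_proj (hφ.mdifferentiableAt (by simp)), hdφ, hdφ] at hφA
  exact hφA

/-- The lift to `T*M` of a vector field and a 1-form on `M`: the sum of the horizontal lift of `X`
and the vertical lift of `ξ`. -/
def lift (D : LinearConnection E M) (X : VField E M) (ξ : OneForm E M) (γ : CotangentBundle E M) :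
    TangentSpace (cotModel E) γ :=
  (splitting D γ).symm (X γ.proj, ξ γ.proj)

variable (D : LinearConnection E M) {X Y Z : VField E M} {ξ η : OneForm E M}

theorem splitting_apply (γ : CotangentBundle E M) (V : TangentSpace (cotModel E) γ) :
    splitting D γ V = (dproj γ V, connector D γ V) := rfl

theorem dproj_lift (γ : CotangentBundle E M) : dproj γ (lift D X ξ γ) = X γ.proj :=
  congrArg Prod.fst ((splitting D γ).apply_symm_apply (X γ.proj, ξ γ.proj))

theorem connector_lift (γ : CotangentBundle E M) : connector D γ (lift D X ξ γ) = ξ γ.proj :=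
  congrArg Prod.snd ((splitting D γ).apply_symm_apply (X γ.proj, ξ γ.proj))

/-- The defining formula of the connector, solved for the derivative. The result is a function on
`M` plus another fibrewise linear function, so it can be differentiated along a lift once more. -/
theorem mvfderiv_fibLin_lift (hZ : SmoothField Z) (γ : CotangentBundle E M) :
    mvfderiv (cotModel E) (fibLin Z) γ (lift D X ξ γ)
      = ξ γ.proj (Z γ.proj) + fibLin (covField D X Z) γ := by
  have h := connector_apply D γ (lift D X ξ γ) (hZ.mdifferentiableAt γ.proj)
  rw [connector_lift, dproj_lift] at h
  rw [h]
  simp [fibLin, covField]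

variable [D.ContMDiffCovariantDerivative ∞]

theorem smoothLiftField_lift [T2Space M] (hX : SmoothField X) (hξ : SmoothOneForm ξ) :
    SmoothLiftField (lift D X ξ) := by
  refine contMDiff_of_dproj_of_fibLin ?_ fun Z hZ ↦ ?_
  · simp only [dproj_lift]
    exact ContMDiff.comp hX contMDiff_cotangent_proj
  · simp only [mvfderiv_fibLin_lift D hZ]
    exact ((hξ Z hZ).comp contMDiff_cotangent_proj).add (hX.covField hZ).contMDiff_fibLin

theorem dproj_mlieBracket_lift [T2Space M] (hX : SmoothField X) (hξ : SmoothOneForm ξ)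
    (hY : SmoothField Y) (hη : SmoothOneForm η) (γ : CotangentBundle E M) :
    dproj γ (mlieBracket (cotModel E) (lift D X ξ) (lift D Y η) γ)
      = mlieBracket 𝓘(ℝ, E) X Y γ.proj :=
  dproj_mlieBracket (smoothLiftField_lift D hX hξ) (smoothLiftField_lift D hY hη) hX hY
    (dproj_lift D) (dproj_lift D) γ

/-- Apply the bracket to `fibLin Z` as a commutator. The terms `ξ(D_Y Z)` and `η(D_X Z)` complete
the derivatives of `ξ(Z)` and `η(Z)` to covariant derivatives; the iterated derivatives of `Z`, with
`D_{[X,Y]} Z` from the connector, form the curvature. -/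
theorem connector_mlieBracket_lift [T2Space M] (hX : SmoothField X) (hξ : SmoothOneForm ξ)
    (hY : SmoothField Y) (hη : SmoothOneForm η) (hZ : SmoothField Z) (γ : CotangentBundle E M) :
    connector D γ (mlieBracket (cotModel E) (lift D X ξ) (lift D Y η) γ) (Z γ.proj)
      = covDerivOneForm D η X Z γ.proj - covDerivOneForm D ξ Y Z γ.proj
        - γ.2 (curvature D X Y Z γ.proj) := by
  have : CompleteSpace E := FiniteDimensional.complete ℝ E
  have hXs := smoothLiftField_lift D hX hξ
  have hYs := smoothLiftField_lift D hY hη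
  have hd {X' Y' : VField E M} {ξ' η' : OneForm E M} (hY' : SmoothField Y')
      (hη' : SmoothOneForm η') :
      mvfderiv (cotModel E) (fun q ↦ mvfderiv (cotModel E) (fibLin Z) q (lift D Y' η' q)) γ
        (lift D X' ξ' γ) = dirDeriv X' (fun x ↦ η' x (Z x)) γ.proj
          + (ξ' γ.proj (covField D Y' Z γ.proj)
            + γ.2 (covField D X' (covField D Y' Z) γ.proj)) := by
    have hYZ := SmoothField.covField (D := D) hY' hZ
    have h1 : (fun q ↦ mvfderiv (cotModel E) (fibLin Z) q (lift D Y' η' q))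
        = (fun q : CotangentBundle E M ↦ η' q.proj (Z q.proj)) + fibLin (covField D Y' Z) := by
      funext q
      exact mvfderiv_fibLin_lift D hZ q
    have h2 := (hη' Z hZ).mdifferentiable (by simp)
    have h3 : MDifferentiableAt (cotModel E) 𝓘(ℝ, ℝ)
        (fun q : CotangentBundle E M ↦ η' q.proj (Z q.proj)) γ :=
      (h2 γ.proj).comp γ (mdifferentiableAt_dproj γ)
    rw [h1, mvfderiv_add h3
      (hYZ.contMDiff_fibLin.mdifferentiable (by simp) γ), add_apply,
      mvfderiv_fibLin_lift D hYZ,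
      mvfderiv_comp_proj (g := fun x ↦ η' x (Z x)) (h2 γ.proj), dproj_lift]
    rfl
  rw [connector_apply D γ _ (hZ.mdifferentiableAt γ.proj), dproj_mlieBracket_lift D hX hξ hY hη,
    mvfderiv_mlieBracket ((hZ.contMDiff_fibLin γ).of_le (by norm_cast))
      (hXs.mdifferentiableAt γ) (hYs.mdifferentiableAt γ), hd hY hη, hd hX hξ]
  simp only [covDerivOneForm, curvature, map_add, map_neg, covField]
  ring

end Lift
end CotangentGeometry

/-! ### The integrability defect and its tensoriality. -/

namespace CotangentGeometry
section Defect

open VectorField Set Filter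
open scoped Topology

variable {F : Type*} [NormedAddCommGroup F] [NormedSpace ℝ F] {H : Type*} [TopologicalSpace H]
  {I : ModelWithCorners ℝ F H} {N : Type*} [TopologicalSpace N] [ChartedSpace H N]

/-- The obstruction at `p` to `[U, V]` being a section of the holomorphic bundle of `J`. -/
def ComplexField.defect (J : Π p : N, TangentSpace I p →ₗ[ℝ] TangentSpace I p)
    (U V : ComplexField I (N := N)) (p : N) : TangentSpace I p :=
  J p ((U.bracket V).re p) + (U.bracket V).im p

/-- The complex vector field `i U`. -/
def ComplexField.mulI (U : ComplexField I (N := N)) : ComplexField I (N := N) where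
  re := -U.im
  im := U.re

/-- The combination of complex vector fields with real functions as coefficients. -/
def ComplexField.sum {κ : Type*} [Fintype κ] (f : κ → N → ℝ) (U : κ → ComplexField I (N := N)) :
    ComplexField I (N := N) where
  re p := ∑ k, f k p • (U k).re p
  im p := ∑ k, f k p • (U k).im p

/-- The complex vector field `U` is differentiable at `p`. -/
def ComplexField.DifferentiableAt [IsManifold I 1 N] (U : ComplexField I (N := N)) (p : N) : Prop :=
  MDifferentiableAt I I.tangent (fun q ↦ (TotalSpace.mk' F q (U.re q) : TangentBundle I N)) p ∧
  MDifferentiableAt I I.tangent (fun q ↦ (TotalSpace.mk' F q (U.im q) : TangentBundle I N)) p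

variable {J : Π p : N, TangentSpace I p →ₗ[ℝ] TangentSpace I p}

/-- Given `J² = -1`, each of the two eigenvector equations is `J` applied to the other, so one
suffices. -/
theorem ComplexField.bracket_isHolomorphicSection_iff (hJ : ∀ p v, J p (J p v) = -v)
    (U V : ComplexField I (N := N)) :
    (U.bracket V).IsHolomorphicSection J ↔ ∀ p, U.defect J V p = 0 := by
  refine ⟨fun h p ↦ ?_, fun h p ↦ ?_⟩
  · rw [defect, (h p).1, neg_add_cancel]
  · have h1 : J p ((U.bracket V).re p) = -(U.bracket V).im p := eq_neg_of_add_eq_zero_left (h p)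
    refine ⟨h1, ?_⟩
    have h2 := congrArg (J p) h1
    rw [hJ, map_neg] at h2
    exact (neg_injective h2).symm

theorem ComplexField.defect_swap (U V : ComplexField I (N := N)) (p : N) :
    V.defect J U p = -U.defect J V p := by
  simp only [defect, bracket]
  rw [mlieBracket_swap_apply (V := V.re) (W := U.re), mlieBracket_swap_apply (V := V.im) (W := U.im),
    mlieBracket_swap_apply (V := V.re) (W := U.im), mlieBracket_swap_apply (V := V.im) (W := U.re)]
  simp only [map_sub, map_neg]
  abel

theorem ComplexField.IsHolomorphicSection.mulI {U : ComplexField I (N := N)}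
    (hU : U.IsHolomorphicSection J) : U.mulI.IsHolomorphicSection J := fun p ↦ by
  simp [ComplexField.mulI, (hU p).1, (hU p).2]

variable [IsManifold I 2 N] [CompleteSpace F]

theorem mlieBracket_sum_smul_left {κ : Type*} (s : Finset κ) {f : κ → N → ℝ}
    {A : κ → Π p : N, TangentSpace I p} {B : Π p : N, TangentSpace I p} {p : N}
    (hf : ∀ k, MDifferentiableAt I 𝓘(ℝ, ℝ) (f k) p)
    (hA : ∀ k, MDifferentiableAt I I.tangent
      (fun q ↦ (TotalSpace.mk' F q (A k q) : TangentBundle I N)) p) :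
    mlieBracket I (fun q ↦ ∑ k ∈ s, f k q • A k q) B p
      = ∑ k ∈ s, (-(mvfderiv I (f k) p (B p)) • A k p + f k p • mlieBracket I (A k) B p) := by
  classical
  induction s using Finset.induction_on with
  | empty =>
    simp only [Finset.sum_empty]
    exact congrFun (mlieBracket_zero_left (I := I) (W := B)) p
  | insert a s ha ih =>
    simp only [Finset.sum_insert ha]
    have h1 : (fun q ↦ f a q • A a q + ∑ k ∈ s, f k q • A k q)
      = (f a • A a) + fun q ↦ ∑ k ∈ s, f k q • A k q := rfl
    have h2 : MDifferentiableAt I I.tangent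
        (fun q ↦ (TotalSpace.mk' F q (∑ k ∈ s, f k q • A k q) : TangentBundle I N)) p :=
      .sum_section (t := fun k ↦ f k • A k) fun k _ ↦ (hf k).smul_section (hA k)
    rw [h1, mlieBracket_add_left ((hf a).smul_section (hA a)) h2, ih, mlieBracket_smul_left (hf a) (hA a)]

/-- The bracket is complex bilinear, so its real and imaginary parts become `-Im` and `Re`; then `J²
= -1` gives the claim. -/
theorem ComplexField.defect_mulI_left (hJ : ∀ p v, J p (J p v) = -v)
    {U : ComplexField I (N := N)} (V : ComplexField I (N := N)) {p : N}
    (hU : U.DifferentiableAt p) :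
    U.mulI.defect J V p = -J p (U.defect J V p) := by
  have hneg (B : Π p : N, TangentSpace I p) :
      mlieBracket I (-U.im) B p = -mlieBracket I U.im B p := by
    rw [← neg_one_smul ℝ U.im, mlieBracket_const_smul_left hU.2, neg_one_smul]
  simp only [defect, bracket, ComplexField.mulI, hneg, map_add, map_sub, map_neg, hJ]
  abel

/-- The Leibniz rule adds to the bracket multiples of `U k` by derivatives of `f k` along `V`. These
are pointwise complex multiples of a holomorphic vector, so they contribute nothing to the defect.
-/
theorem ComplexField.defect_sum_left {κ : Type*} [Fintype κ] {f : κ → N → ℝ}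
    {U : κ → ComplexField I (N := N)} (V : ComplexField I (N := N)) {p : N}
    (hf : ∀ k, MDifferentiableAt I 𝓘(ℝ, ℝ) (f k) p) (hU : ∀ k, (U k).DifferentiableAt p)
    (hJU : ∀ k, (U k).IsHolomorphicSection J) :
    (ComplexField.sum f U).defect J V p = ∑ k, f k p • (U k).defect J V p := by
  simp only [defect, bracket, ComplexField.sum]
  rw [mlieBracket_sum_smul_left _ hf fun k ↦ (hU k).1, mlieBracket_sum_smul_left _ hf fun k ↦ (hU k).2,
    mlieBracket_sum_smul_left _ hf fun k ↦ (hU k).1, mlieBracket_sum_smul_left _ hf fun k ↦ (hU k).2,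
    ← Finset.sum_sub_distrib, map_sum, ← Finset.sum_add_distrib, ← Finset.sum_add_distrib]
  refine Finset.sum_congr rfl fun k _ ↦ ?_
  simp only [map_sub, map_add, map_smul, (hJU k p).1, (hJU k p).2]
  module

omit [IsManifold I 2 N] [CompleteSpace F] in
theorem ComplexField.defect_congr {U U' V V' : ComplexField I (N := N)} {p : N}
    (hre : U.re =ᶠ[𝓝 p] U'.re) (him : U.im =ᶠ[𝓝 p] U'.im)
    (hre' : V.re =ᶠ[𝓝 p] V'.re) (him' : V.im =ᶠ[𝓝 p] V'.im) :
    U.defect J V p = U'.defect J V' p := by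
  simp only [defect, bracket, hre.mlieBracket_vectorField_eq hre',
    hre.mlieBracket_vectorField_eq him', him.mlieBracket_vectorField_eq hre',
    him.mlieBracket_vectorField_eq him']

theorem ComplexField.defect_sum_sum_eq_zero {κ : Type*} [Fintype κ] {f g : κ → N → ℝ}
    {U : κ → ComplexField I (N := N)} {p : N}
    (hf : ∀ k, MDifferentiableAt I 𝓘(ℝ, ℝ) (f k) p)
    (hg : ∀ k, MDifferentiableAt I 𝓘(ℝ, ℝ) (g k) p) (hU : ∀ k, (U k).DifferentiableAt p)
    (hJU : ∀ k, (U k).IsHolomorphicSection J) (h : ∀ k l, (U k).defect J (U l) p = 0) :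
    (ComplexField.sum f U).defect J (ComplexField.sum g U) p = 0 := by
  rw [ComplexField.defect_sum_left _ hf hU hJU]
  refine Finset.sum_eq_zero fun k _ ↦ ?_
  rw [ComplexField.defect_swap, ComplexField.defect_sum_left _ hg hU hJU]
  simp [h]

end Defect

/-! ### The special holomorphic sections. -/

section Main

open VectorField Set Filter
open scoped Topology

variable {E : Type*} [NormedAddCommGroup E] [NormedSpace ℝ E] [FiniteDimensional ℝ E]
  {M : Type*} [TopologicalSpace M] [ChartedSpace E M] [IsManifold 𝓘(ℝ, E) ∞ M]

/-- The coefficients are the coordinates of `dπ(A)` in a trivialization of `TM`; they are functions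
on `T*M`. Differentiability at `γ₀` is enough, since the bracket is of first order. -/
theorem exists_smooth_local_frame [T2Space M] (γ₀ : CotangentBundle E M) :
    ∃ X : Fin (Module.finrank ℝ E) → VField E M, (∀ i, SmoothField (X i)) ∧
      ∀ A : Π γ : CotangentBundle E M, TangentSpace (cotModel E) γ, SmoothLiftField A →
        ∃ a : Fin (Module.finrank ℝ E) → CotangentBundle E M → ℝ,
          (∀ i, MDifferentiableAt (cotModel E) 𝓘(ℝ, ℝ) (a i) γ₀) ∧
          ∀ᶠ γ in 𝓝 γ₀, dproj γ (A γ) = ∑ i, a i γ • X i γ.proj := by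
  let b := Module.finBasis ℝ E
  let t := trivializationAt E (TangentSpace 𝓘(ℝ, E) : M → Type _) γ₀.proj
  choose X hX hXt using fun i ↦ exists_smoothField_eventuallyEq γ₀.proj (b i)
  refine ⟨X, hX, fun A hA ↦ ?_⟩
  let w : CotangentBundle E M → E := fun γ ↦ (t ⟨γ.proj, dproj γ (A γ)⟩).2
  have hw : MDifferentiableAt (cotModel E) 𝓘(ℝ, E) w γ₀ :=
    (contMDiffAt_totalSpace.1 (contMDiff_dproj hA γ₀)).2.mdifferentiableAt (by simp)
  refine ⟨fun i γ ↦ b.repr (w γ) i, fun i ↦ ?_, ?_⟩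
  · exact ((b.coord i).toContinuousLinearMap.mdifferentiableAt).comp γ₀ hw
  · have hc : ContinuousAt (fun γ : CotangentBundle E M ↦ γ.proj) γ₀ :=
      (FiberBundle.continuous_proj (E →L[ℝ] ℝ) _).continuousAt
    have hb : ∀ᶠ x in 𝓝 γ₀.proj, x ∈ t.baseSet :=
      t.open_baseSet.mem_nhds (FiberBundle.mem_baseSet_trivializationAt' γ₀.proj)
    filter_upwards [hc.eventually (hb.and (eventually_all.2 hXt))] with γ ⟨hγ, hγX⟩
    simp only [hγX]
    have h1 : dproj γ (A γ) = t.symmL ℝ γ.proj (w γ) := by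
      rw [Trivialization.symmL_apply (R := ℝ) t hγ]
      exact (t.symm_apply_apply_mk hγ _).symm
    rw [h1]
    conv_lhs => rw [← b.sum_repr (w γ)]
    rw [map_sum]
    refine Finset.sum_congr rfl fun i _ ↦ ?_
    rw [map_smul, Trivialization.symmL_apply (R := ℝ) t hγ]

variable (D : LinearConnection E M) (Ω : NondegenerateTwoForm E M)

/-- The 1-form `Ω(X, ·)`. -/
def NondegenerateTwoForm.flat (X : VField E M) : OneForm E M := fun x ↦ Ω.form x (X x)

omit [FiniteDimensional ℝ E] in
theorem NondegenerateTwoForm.smoothOneForm_flat {X : VField E M} (hX : SmoothField X) :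
    SmoothOneForm (Ω.flat X) := by
  intro Y hY x
  have h := ContMDiffAt.clm_bundle_apply₂ (F₁ := E) (F₂ := E) (F₃ := ℝ)
    (E₁ := fun x : M ↦ TangentSpace 𝓘(ℝ, E) x) (E₂ := fun x : M ↦ TangentSpace 𝓘(ℝ, E) x)
    (E₃ := Trivial M ℝ) (b := id) (Ω.smooth x) (hX x) (hY x)
  exact (contMDiffAt_totalSpace.1 h).2

omit [FiniteDimensional ℝ E] in
theorem smoothOneForm_zero : SmoothOneForm (0 : OneForm E M) := fun _ _ ↦ contMDiff_const

omit [FiniteDimensional ℝ E] in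
theorem smoothField_zero : SmoothField (0 : VField E M) := contMDiff_zeroSection _ _

omit [FiniteDimensional ℝ E] in
theorem NondegenerateTwoForm.swap (x : M) (v w : TangentSpace 𝓘(ℝ, E) x) :
    Ω.form x v w = -Ω.form x w v := by
  have h := Ω.alternating x (v + w)
  simp only [map_add, add_apply, Ω.alternating, zero_add, add_zero] at h
  linarith

/-- The section `X^h + i Ω(X, ·)^v` of the holomorphic bundle. -/
def holomorphicLift (X : VField E M) :
    ComplexField (cotModel E) (N := CotangentBundle E M) where
  re := lift D X 0
  im := lift D 0 (Ω.flat X)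

theorem splitting_lift (X : VField E M) (ξ : OneForm E M) (γ : CotangentBundle E M) :
    splitting D γ (lift D X ξ γ) = (X γ.proj, ξ γ.proj) :=
  (splitting D γ).apply_symm_apply _

theorem splitting_inducedEndomorphism (γ : CotangentBundle E M) (V : TangentSpace (cotModel E) γ) :
    splitting D γ (inducedEndomorphism D Ω.genComplex γ V)
      = ((Ω.toEquiv γ.proj).symm (connector D γ V), -Ω.form γ.proj (dproj γ V)) :=
  (splitting D γ).apply_symm_apply _

theorem isHolomorphicSection_holomorphicLift (X : VField E M) :
    (holomorphicLift D Ω X).IsHolomorphicSection (inducedEndomorphism D Ω.genComplex) := by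
  intro γ
  constructor
  · apply (splitting D γ).injective
    rw [splitting_inducedEndomorphism, map_neg, splitting_apply]
    simp [holomorphicLift, dproj_lift, connector_lift, NondegenerateTwoForm.flat]
  · apply (splitting D γ).injective
    rw [splitting_inducedEndomorphism, splitting_apply]
    have h : (Ω.toEquiv γ.proj).symm (Ω.flat X γ.proj) = X γ.proj :=
      (Ω.toEquiv γ.proj).symm_apply_apply (X γ.proj)
    simp [holomorphicLift, dproj_lift, connector_lift, h]

/-- The eigenvector equations express the vertical parts of a holomorphic vector through its two
horizontal parts. Hence `dπ` of the real and imaginary parts determines it, and `a i + i b i` are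
its complex coefficients. -/
theorem eq_sum_holomorphicLift_of_dproj {U : ComplexField (cotModel E) (N := CotangentBundle E M)}
    (hU : U.IsHolomorphicSection (inducedEndomorphism D Ω.genComplex)) {κ : Type*} [Fintype κ]
    {X : κ → VField E M} {a b : κ → ℝ} {γ : CotangentBundle E M}
    (ha : dproj γ (U.re γ) = ∑ i, a i • X i γ.proj)
    (hb : dproj γ (U.im γ) = ∑ i, b i • X i γ.proj) :
    U.re γ = ∑ i, (a i • (holomorphicLift D Ω (X i)).re γ - b i • (holomorphicLift D Ω (X i)).im γ) ∧
    U.im γ = ∑ i, (a i • (holomorphicLift D Ω (X i)).im γ + b i • (holomorphicLift D Ω (X i)).re γ) := by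
  have hre : connector D γ (U.re γ) = -Ω.form γ.proj (dproj γ (U.im γ)) := by
    rw [← (hU γ).2]
    exact congrArg Prod.snd (splitting_inducedEndomorphism D Ω γ (U.im γ))
  have him : connector D γ (U.im γ) = Ω.form γ.proj (dproj γ (U.re γ)) := by
    have h := congrArg Prod.snd (splitting_inducedEndomorphism D Ω γ (U.re γ))
    rw [(hU γ).1, map_neg, splitting_apply] at h
    exact neg_injective h
  constructor <;> apply (splitting D γ).injective
  · rw [splitting_apply, hre, hb, ha]
    simp only [map_sum, map_sub, map_smul, holomorphicLift, splitting_lift]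
    apply Prod.ext
    · simp [Prod.fst_sum]
    · simp [Prod.snd_sum, NondegenerateTwoForm.flat]
  · rw [splitting_apply, him, hb, ha]
    simp only [map_sum, map_add, map_smul, holomorphicLift, splitting_lift]
    apply Prod.ext
    · simp [Prod.fst_sum]
    · simp [Prod.snd_sum, NondegenerateTwoForm.flat]

omit [FiniteDimensional ℝ E] in
theorem covField_zero_left (Y : VField E M) : covField D 0 Y = 0 := by
  funext x
  exact map_zero (D Y x)

omit [FiniteDimensional ℝ E] in
theorem covField_zero_right (X : VField E M) : covField D X 0 = 0 := by
  funext x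
  have h : D (0 : VField E M) x = 0 := D.isCovariantDerivativeOnUniv.zero (Set.mem_univ x)
  simp [covField, h]

omit [FiniteDimensional ℝ E] in
theorem curvature_zero_left (Y Z : VField E M) : curvature D 0 Y Z = 0 := by
  funext x
  simp [curvature, covField_zero_left, covField_zero_right]

omit [FiniteDimensional ℝ E] in
theorem curvature_zero_right (X Z : VField E M) : curvature D X 0 Z = 0 := by
  funext x
  simp [curvature, covField_zero_left, covField_zero_right]

omit [FiniteDimensional ℝ E] in
theorem covDerivOneForm_zero_form (X Z : VField E M) (x : M) :
    covDerivOneForm D (0 : OneForm E M) X Z x = 0 := by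
  simp [covDerivOneForm, dirDeriv, mvfderiv_const]

omit [FiniteDimensional ℝ E] in
theorem covDerivOneForm_zero_field (s : OneForm E M) (Z : VField E M) (x : M) :
    covDerivOneForm D s 0 Z x = 0 := by
  simp [covDerivOneForm, dirDeriv, covField_zero_left]

variable [D.ContMDiffCovariantDerivative ∞] [T2Space M]

theorem smooth_holomorphicLift {X : VField E M} (hX : SmoothField X) :
    (holomorphicLift D Ω X).Smooth :=
  ⟨smoothLiftField_lift D hX smoothOneForm_zero,
    smoothLiftField_lift D smoothField_zero (Ω.smoothOneForm_flat hX)⟩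

/-- The real part of the bracket projects to `[X, Y]` with vertical part `-γ ∘ R_{X,Y}`; the
imaginary part is vertical, equal to `D_X(ΩY) - D_Y(ΩX)`. The two components of the defect under
`splitting` give the two equations. -/
theorem defect_holomorphicLift_eq_zero_iff {X Y : VField E M} (hX : SmoothField X)
    (hY : SmoothField Y) (γ : CotangentBundle E M) :
    (holomorphicLift D Ω X).defect (inducedEndomorphism D Ω.genComplex) (holomorphicLift D Ω Y) γ = 0
      ↔ ∀ Z : VField E M, SmoothField Z → γ.2 (curvature D X Y Z γ.proj) = 0 ∧
        Ω.form γ.proj (mlieBracket 𝓘(ℝ, E) X Y γ.proj) (Z γ.proj)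
          = covDerivOneForm D (Ω.flat Y) X Z γ.proj - covDerivOneForm D (Ω.flat X) Y Z γ.proj := by
  set U := holomorphicLift D Ω X
  set V := holomorphicLift D Ω Y
  set R := (U.bracket V).re γ with hR
  set S := (U.bracket V).im γ with hS
  have hΩX := Ω.smoothOneForm_flat hX
  have hΩY := Ω.smoothOneForm_flat hY
  have hRd : dproj γ R = mlieBracket 𝓘(ℝ, E) X Y γ.proj := by
    simp only [hR, U, V, holomorphicLift, ComplexField.bracket]
    rw [(dproj γ).map_sub, dproj_mlieBracket_lift D hX smoothOneForm_zero hY smoothOneForm_zero,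
      dproj_mlieBracket_lift D smoothField_zero hΩX smoothField_zero hΩY]
    simp
  have hSd : dproj γ S = 0 := by
    simp only [hS, U, V, holomorphicLift, ComplexField.bracket]
    rw [(dproj γ).map_add, dproj_mlieBracket_lift D hX smoothOneForm_zero smoothField_zero hΩY,
      dproj_mlieBracket_lift D smoothField_zero hΩX hY smoothOneForm_zero]
    simp
  have hRK (Z : VField E M) (hZ : SmoothField Z) :
      connector D γ R (Z γ.proj) = -γ.2 (curvature D X Y Z γ.proj) := by
    simp only [hR, U, V, holomorphicLift, ComplexField.bracket, map_sub, sub_apply]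
    rw [connector_mlieBracket_lift D hX smoothOneForm_zero hY smoothOneForm_zero hZ,
      connector_mlieBracket_lift D smoothField_zero hΩX smoothField_zero hΩY hZ]
    simp [covDerivOneForm_zero_form, covDerivOneForm_zero_field, curvature_zero_left]
  have hSK (Z : VField E M) (hZ : SmoothField Z) : connector D γ S (Z γ.proj)
      = covDerivOneForm D (Ω.flat Y) X Z γ.proj - covDerivOneForm D (Ω.flat X) Y Z γ.proj := by
    simp only [hS, U, V, holomorphicLift, ComplexField.bracket, map_add, add_apply]
    rw [connector_mlieBracket_lift D hX smoothOneForm_zero smoothField_zero hΩY hZ,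
      connector_mlieBracket_lift D smoothField_zero hΩX hY smoothOneForm_zero hZ]
    simp [covDerivOneForm_zero_field, curvature_zero_left, curvature_zero_right, sub_eq_add_neg]
  have hsplit : splitting D γ (U.defect (inducedEndomorphism D Ω.genComplex) V γ)
      = ((Ω.toEquiv γ.proj).symm (connector D γ R),
        -Ω.form γ.proj (mlieBracket 𝓘(ℝ, E) X Y γ.proj) + connector D γ S) := by
    rw [ComplexField.defect, map_add, splitting_inducedEndomorphism, splitting_apply, ← hR, ← hS,
      hRd, hSd]
    simp
  rw [← (splitting D γ).map_eq_zero_iff, hsplit, Prod.mk_eq_zero, LinearEquiv.map_eq_zero_iff]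
  constructor
  · rintro ⟨h1, h2⟩ Z hZ
    refine ⟨?_, ?_⟩
    · have h := hRK Z hZ
      rw [h1] at h
      simpa using h.symm
    · rw [← hSK Z hZ, ← neg_add_eq_zero]
      exact DFunLike.congr_fun h2 (Z γ.proj)
  · intro h
    constructor
    · ext v
      obtain ⟨Z, hZ, rfl⟩ := exists_smoothField_eq v
      rw [hRK Z hZ, (h Z hZ).1]
      simp
    · ext v
      obtain ⟨Z, hZ, rfl⟩ := exists_smoothField_eq v
      have h' := (h Z hZ).2
      rw [← hSK Z hZ] at h'
      simp [h']

omit [D.ContMDiffCovariantDerivative ∞] [T2Space M] in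
/-- The condition on `dΩ`, `DΩ` and the torsion says that `Ω([X, Y], ·) = D_X (ΩY) - D_Y (ΩX)`. -/
theorem extDeriv_sub_covDeriv_sub_torsion {X Y Z : VField E M} (hX : SmoothField X)
    (hY : SmoothField Y) (hZ : SmoothField Z) (x : M) :
    extDerivTwoForm Ω.form X Y Z x - covDerivTwoForm D Ω.form Z X Y x
      - Ω.form x (D.torsion x (Z x) (X x)) (Y x) - Ω.form x (X x) (D.torsion x (Z x) (Y x))
      = covDerivOneForm D (Ω.flat Y) X Z x - covDerivOneForm D (Ω.flat X) Y Z x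
        - Ω.form x (mlieBracket 𝓘(ℝ, E) X Y x) (Z x) := by
  have : CompleteSpace E := FiniteDimensional.complete ℝ E
  have : IsManifold 𝓘(ℝ, E) 2 M := IsManifold.of_le (n := ∞) (by norm_cast)
  rw [D.torsion_apply (hZ.mdifferentiableAt x) (hX.mdifferentiableAt x),
    D.torsion_apply (hZ.mdifferentiableAt x) (hY.mdifferentiableAt x)]
  have hd : dirDeriv Y (fun y ↦ Ω.form y (Z y) (X y)) x
      = -dirDeriv Y (fun y ↦ Ω.form y (X y) (Z y)) x := by
    have h : (fun y ↦ Ω.form y (Z y) (X y)) = -fun y ↦ Ω.form y (X y) (Z y) := by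
      funext y
      exact Ω.swap y _ _
    rw [h, dirDeriv, mvfderiv_neg]
    rfl
  simp only [extDerivTwoForm, covDerivTwoForm, covDerivOneForm, NondegenerateTwoForm.flat, covField,
    map_sub, sub_apply, hd]
  -- After expanding the torsion, all terms with `D_Z`, `[Y, Z]`, `[Z, X]` or a `Z`-derivative
  -- cancel, up to the antisymmetries used here.
  rw [Ω.swap x (mlieBracket 𝓘(ℝ, E) Y Z x), mlieBracket_swap_apply (V := Z) (W := Y), map_neg,
    Ω.swap x (D X x (Z x)), Ω.swap x (D Z x (X x))]
  ring

end Main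
end CotangentGeometry

/-! ### The equivalence. -/

open CotangentGeometry in
theorem lemma5p3 {E : Type*} [NormedAddCommGroup E] [NormedSpace ℝ E] [FiniteDimensional ℝ E]
    {M : Type*} [TopologicalSpace M] [T2Space M] [ChartedSpace E M] [IsManifold 𝓘(ℝ, E) ∞ M]
    (Ω : NondegenerateTwoForm E M)
    (D : LinearConnection E M) [D.ContMDiffCovariantDerivative ∞] :
    IsIntegrable (I := cotModel E) (N := CotangentBundle E M)
        (inducedEndomorphism D Ω.genComplex) ↔
      IsFlat D ∧
        ∀ X Y Z : VField E M, SmoothField X → SmoothField Y → SmoothField Z → ∀ x : M,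
          extDerivTwoForm Ω.form X Y Z x - covDerivTwoForm D Ω.form Z X Y x
            - Ω.form x (D.torsion x (Z x) (X x)) (Y x)
            - Ω.form x (X x) (D.torsion x (Z x) (Y x)) = 0 := by
  have hJ := inducedEndomorphism_sq D Ω
  constructor
  · intro hint
    have key (X Y : VField E M) (hX : SmoothField X) (hY : SmoothField Y)
        (γ : CotangentBundle E M) :=
      (defect_holomorphicLift_eq_zero_iff D Ω hX hY γ).1
        ((ComplexField.bracket_isHolomorphicSection_iff hJ _ _).1
          (hint _ _ (smooth_holomorphicLift D Ω hX) (smooth_holomorphicLift D Ω hY)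
            (isHolomorphicSection_holomorphicLift D Ω X)
            (isHolomorphicSection_holomorphicLift D Ω Y)) γ)
    refine ⟨fun X Y Z hX hY hZ x ↦ ?_, fun X Y Z hX hY hZ x ↦ ?_⟩
    -- The covector `γ` is free in the curvature equation; the choice `γ = Ω(w, ·)` lets
    -- non-degeneracy conclude.
    · refine Ω.nondegenerate x _ fun w ↦ ?_
      rw [Ω.swap, (key X Y hX hY ⟨x, Ω.form x w⟩ Z hZ).1, neg_zero]
    -- The second equation depends only on the base point, so the zero covector serves.
    · rw [extDeriv_sub_covDeriv_sub_torsion D Ω hX hY hZ, ← (key X Y hX hY ⟨x, 0⟩ Z hZ).2, sub_self]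
  · rintro ⟨hflat, hcond⟩ U V hU hV hUJ hVJ
    rw [ComplexField.bracket_isHolomorphicSection_iff hJ]
    intro γ
    obtain ⟨X, hX, hframe⟩ := exists_smooth_local_frame γ
    have : CompleteSpace E := FiniteDimensional.complete ℝ E
    have : IsManifold (cotModel E) 2 (CotangentBundle E M) :=
      IsManifold.of_le (n := ∞) (by norm_cast)
    let W := fun i ↦ holomorphicLift D Ω (X i)
    have hW (i) : (W i).DifferentiableAt γ :=
      ⟨SmoothLiftField.mdifferentiableAt (smooth_holomorphicLift D Ω (hX i)).1 γ,
        SmoothLiftField.mdifferentiableAt (smooth_holomorphicLift D Ω (hX i)).2 γ⟩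
    have hWi (i) : (W i).mulI.DifferentiableAt γ :=
      ⟨mdifferentiableAt_neg_section (hW i).2, (hW i).1⟩
    have hWJ (i) := isHolomorphicSection_holomorphicLift D Ω (X i)
    have hWW (i j) : (W i).defect (inducedEndomorphism D Ω.genComplex) (W j) γ = 0 := by
      refine (defect_holomorphicLift_eq_zero_iff D Ω (hX i) (hX j) γ).2 fun Z hZ ↦ ⟨?_, ?_⟩
      · rw [hflat _ _ _ (hX i) (hX j) hZ, map_zero]
      · have h := hcond _ _ _ (hX i) (hX j) hZ γ.proj
        rw [extDeriv_sub_covDeriv_sub_torsion D Ω (hX i) (hX j) hZ] at h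
        exact (sub_eq_zero.1 h).symm
    -- Adjoining `i W_j` to the `W_j` turns combinations with complex coefficients into combinations
    -- with real ones.
    let B := Sum.elim W fun i ↦ (W i).mulI
    have hB (k) : (B k).DifferentiableAt γ := Sum.rec hW hWi k
    have hBJ (k) : (B k).IsHolomorphicSection (inducedEndomorphism D Ω.genComplex) :=
      Sum.rec hWJ (fun i ↦ (hWJ i).mulI) k
    have hWB (i k) : (W i).defect (inducedEndomorphism D Ω.genComplex) (B k) γ = 0 := by
      rcases k with j | j
      · exact hWW i j
      · rw [ComplexField.defect_swap]
        change -(W j).mulI.defect _ _ γ = 0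
        rw [ComplexField.defect_mulI_left hJ _ (hW j), hWW]
        simp
    have hBB (k l) : (B k).defect (inducedEndomorphism D Ω.genComplex) (B l) γ = 0 := by
      rcases k with i | i
      · exact hWB i l
      · change (W i).mulI.defect _ _ γ = 0
        rw [ComplexField.defect_mulI_left hJ _ (hW i), hWB]
        simp
    have expand (U : ComplexField (cotModel E) (N := CotangentBundle E M)) (hU : U.Smooth)
        (hUJ : U.IsHolomorphicSection (inducedEndomorphism D Ω.genComplex)) :
        ∃ f : _ → CotangentBundle E M → ℝ, (∀ k, MDifferentiableAt (cotModel E) 𝓘(ℝ, ℝ) (f k) γ) ∧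
          U.re =ᶠ[nhds γ] (ComplexField.sum f B).re ∧
          U.im =ᶠ[nhds γ] (ComplexField.sum f B).im := by
      obtain ⟨a, ha, ha'⟩ := hframe U.re hU.1
      obtain ⟨b, hb, hb'⟩ := hframe U.im hU.2
      refine ⟨Sum.elim a b, fun k ↦ Sum.rec ha hb k, ?_, ?_⟩
      · filter_upwards [ha', hb'] with q hq hq'
        rw [(eq_sum_holomorphicLift_of_dproj D Ω hUJ hq hq').1]
        simp [ComplexField.sum, B, W, ComplexField.mulI, sub_eq_add_neg, Finset.sum_add_distrib]
        rfl
      · filter_upwards [ha', hb'] with q hq hq'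
        rw [(eq_sum_holomorphicLift_of_dproj D Ω hUJ hq hq').2]
        simp [ComplexField.sum, B, W, ComplexField.mulI, Finset.sum_add_distrib]
        rfl
    obtain ⟨f, hf, hfre, hfim⟩ := expand U hU hUJ
    obtain ⟨g, hg, hgre, hgim⟩ := expand V hV hVJ
    -- The expansions hold only near `γ`, which suffices because the bracket is local.
    rw [ComplexField.defect_congr hfre hfim hgre hgim]
    exact ComplexField.defect_sum_sum_eq_zero hf hg hB hBJ hBB
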